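/- Setting. Let $(X,d)$ be a metric space that is the disjoint union $X=\bigsqcup_{n\in\mathbb N}X_n$ of non-empty finite subsets such that $d(X_n,X_m)\to\infty$ as $n+m\to\infty$ with $n\ne m$ (a sparse space), and let $d_n$ be the restriction of $d$ to $X_n$. For a complex Hilbert space $\mathcal H_0$, a block-rank-one projection on $\ell^2(X;\mathcal H_0)$ is an orthogonal projection of the form $P=\bigoplus_n P_n$ on $\ell^2(X;\mathcal H_0)=\bigoplus_n\ell^2(X_n;\mathcal H_0)$, where each $P_n$ is a rank-one projection in $\mathfrak B(\ell^2(X_n;\mathcal H_0))$; thus $P_n\eta=\langle\eta,\xi_n\rangle\xi_n$ for a unit vector $\xi_n\in\ell^2(X_n;\mathcal H_0)$. The associated probability measure $m_n$ on $X_n$ is $m_n(x)=\|P_n\chi_{\{x\}}\|^2=\|\xi_n(x)\|^2$, where $\chi_A$ denotes multiplication by the characteristic function of $A$. The uniformization of $P$ is the block-rank-one projection $\widetilde P=\bigoplus_n\langle\,\cdot\,,\widetilde\xi_n\rangle\widetilde\xi_n$ on $\ell^2(X)=\ell^2(X;\mathbb C)$, where $\widetilde\xi_n(x)=\|\xi_n(x)\|$;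 it does not depend on the choice of the vectors $\xi_n$. An operator $T$ on $\ell^2(X;\mathcal H_0)$, with matrix entries $T_{x,y}\in\mathfrak B(\mathcal H_0)$, has finite propagation if $\sup\{d(x,y):T_{x,y}\ne0\}<\infty$, and is locally compact if all $T_{x,y}$ are compact. It is quasi-local if for every $\varepsilon>0$ there is $R>0$ such that $\|\chi_AT\chi_B\|<\varepsilon$ whenever $A,B\subseteq X$ and $d(A,B)>R$. The uniform Roe algebra $C^*_u(X)$ is the norm closure of the finite propagation operators in $\mathfrak B(\ell^2(X))$; the Roe algebra $C^*(X)$ is, for $\mathcal H_0$ separable and infinite-dimensional, the norm closure of the locally compact finite propagation operators in $\mathfrak B(\ell^2(X;\mathcal H_0))$. The space $X$ has bounded geometry if $\sup_{x\in X}|\{y:d(x,y)\le R\}|<\infty$ for every $R>0$. The sequence $(X_n,d_n,m_n)$ is a sequence of measured asymptotic expanders if for every $\alpha\in(0,\frac12]$ there are $c_\alpha\in(0,1)$ and $R_\alpha>0$ such that for all $n$ and all $A\subseteq X_n$ with $\alpha\le m_n(A)\le\frac12$ one has $m_n(\{x\in X_n\setminus A:d_n(x,A)\le R_\alpha\})>c_\alpha\,m_n(A)$.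 Theorem B. Let $P$ be a block-rank-one projection on $\ell^2(X;\mathcal H_0)$ with respect to $(X_n)$, with associated probability measures $m_n$. (1) For every complex Hilbert space $\mathcal H_0$ (and without assuming bounded geometry), $P$ is quasi-local if and only if $(X_n,d_n,m_n)$ is a sequence of measured asymptotic expanders. (2) If $X$ has bounded geometry and $\mathcal H_0=\mathbb C$, the following are equivalent: $P\in C^*_u(X)$; $P$ is quasi-local; $(X_n,d_n,m_n)$ is a sequence of measured asymptotic expanders. (3) If $X$ has bounded geometry and $\mathcal H_0$ is separable and infinite-dimensional, then $P$ has exactly one uniformization $\widetilde P$, and the following are equivalent: $P\in C^*(X)$; $P$ is quasi-local; $(X_n,d_n,m_n)$ is a sequence of measured asymptotic expanders; $\widetilde P\in C^*_u(X)$; $\widetilde P$ is quasi-local. -/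

import Mathlib

open scoped ENNReal InnerProductSpace

namespace RoeBlock

noncomputable section

/-! ### Metric notions -/

/-- The distance `d(A, B) = inf {d(a, b) : a ∈ A, b ∈ B}` between two subsets, as an extended
nonnegative real (it is `∞` when one of the sets is empty). -/
def setEDist {X : Type*} [MetricSpace X] (A B : Set X) : ℝ≥0∞ :=
  ⨅ a ∈ A, ⨅ b ∈ B, edist a b

/-- `X` has bounded geometry: for each `R > 0` the closed balls of radius `R` have uniformly
bounded (finite) cardinality. -/
def BoundedGeometry (X : Type*) [MetricSpace X] : Prop :=
  ∀ R : ℝ, 0 < R → ∃ N : ℕ, ∀ x : X, (Metric.closedBall x R).encard ≤ N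

/-- `X = ⨆ₙ Xₙ` is a coarse disjoint union of the nonempty finite subspaces `Xₙ`, i.e. a sparse
space together with the partition witnessing this. -/
structure IsCoarseDisjointUnion {X : Type*} [MetricSpace X] (Xn : ℕ → Finset X) : Prop where
  nonempty : ∀ n, (Xn n).Nonempty
  disjoint : Pairwise fun n m => Disjoint (Xn n) (Xn m)
  cover : ∀ x : X, ∃ n, x ∈ Xn n
  dist_tendsto : ∀ C : ℝ, ∃ N : ℕ, ∀ n m : ℕ, n ≠ m → N ≤ n + m →
    ENNReal.ofReal C ≤ setEDist (Xn n : Set X) (Xn m : Set X)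

/-- The outer `R`-boundary `{x ∉ A : d(x, A) ≤ R}`. -/
def outerBoundary {Y : Type*} [MetricSpace Y] (R : ℝ) (A : Set Y) : Set Y :=
  {x | x ∉ A ∧ Metric.infEDist x A ≤ ENNReal.ofReal R}

/-- The measure `m(A) = ∑_{x ∈ A} m(x)` of a subset of a finite set with point masses `m`. -/
def mass {Y : Type*} [Fintype Y] (m : Y → ℝ) (A : Set Y) : ℝ :=
  ∑ x, A.indicator m x

/-- A sequence `(Yₙ, dₙ, mₙ)` of finite metric spaces with probability measures (given by their
point masses) is a sequence of measured asymptotic expanders. -/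
structure MeasuredAsymptoticExpanders (Y : ℕ → Type*) [∀ n, MetricSpace (Y n)]
    [∀ n, Fintype (Y n)] (m : ∀ n, Y n → ℝ) : Prop where
  mass_nonneg : ∀ n x, 0 ≤ m n x
  mass_univ : ∀ n, mass (m n) Set.univ = 1
  expansion : ∀ α : ℝ, 0 < α → α ≤ 1 / 2 → ∃ c : ℝ, 0 < c ∧ c < 1 ∧ ∃ R : ℝ, 0 < R ∧
    ∀ (n : ℕ) (A : Set (Y n)), α ≤ mass (m n) A → mass (m n) A ≤ 1 / 2 →
      c * mass (m n) A < mass (m n) (outerBoundary R A)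

/-! ### Operators on `ℓ²(X; H)` -/

/-- The Hilbert space `ℓ²(X; H)`. -/
abbrev Ell2 (X H : Type*) [NormedAddCommGroup H] : Type _ := lp (fun _ : X => H) 2

theorem memℓp_indicator {X H : Type*} [NormedAddCommGroup H] (A : Set X) (f : Ell2 X H) : Memℓp (A.indicator ⇑f) 2 :=
  (lp.memℓp f).mono' fun x => norm_indicator_le_norm_self (⇑f) x

theorem memℓp_norm {X H : Type*} [NormedAddCommGroup H] (ξ : Ell2 X H) : Memℓp (fun x => ((‖ξ x‖ : ℝ) : ℂ)) 2 :=
  (lp.memℓp ξ).mono' fun x => by simp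

section Operators

variable {X H : Type*} [NormedAddCommGroup H] [InnerProductSpace ℂ H]

/-- The operator `χ_A` on `ℓ²(X; H)` of multiplication by the characteristic function of `A`. -/
def chi (A : Set X) : Ell2 X H →L[ℂ] Ell2 X H :=
  LinearMap.mkContinuous
    { toFun := fun f => ⟨A.indicator ⇑f, memℓp_indicator A f⟩
      map_add' := fun f g => Subtype.ext (by
        simp only [lp.coeFn_add]
        exact Set.indicator_add A (⇑f) (⇑g))
      map_smul' := fun c f => Subtype.ext (by
        simp only [lp.coeFn_smul, RingHom.id_apply]
        exact Set.indicator_const_smul A c (⇑f)) }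
    1 fun f => by
      rw [one_mul]
      exact lp.norm_mono (by norm_num) fun x => norm_indicator_le_norm_self (⇑f) x

open Classical in
/-- The matrix entry `T_{x,y} : H → H`, `T_{x,y} ξ = (T (δ_y ⊗ ξ)) (x)`. -/
def entry (T : Ell2 X H →L[ℂ] Ell2 X H) (x y : X) : H →L[ℂ] H :=
  (lp.evalCLM ℂ (fun _ : X => H) 2 x).comp
    (T.comp (lp.singleContinuousLinearMap ℂ (fun _ : X => H) 2 y))

/-- `T` has finite propagation: `sup {d(x, y) : T_{x,y} ≠ 0}` is finite. -/
def FinitePropagation [MetricSpace X] (T : Ell2 X H →L[ℂ] Ell2 X H) : Prop :=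
  ∃ R : ℝ, ∀ x y : X, entry T x y ≠ 0 → dist x y ≤ R

/-- `T` is locally compact: all its matrix entries are compact operators. -/
def LocallyCompactOp (T : Ell2 X H →L[ℂ] Ell2 X H) : Prop :=
  ∀ x y : X, IsCompactOperator (entry T x y)

/-- `T` is quasi-local. -/
def QuasiLocal [MetricSpace X] (T : Ell2 X H →L[ℂ] Ell2 X H) : Prop :=
  ∀ ε : ℝ, 0 < ε → ∃ R : ℝ, 0 < R ∧ ∀ A B : Set X,
    ENNReal.ofReal R < setEDist A B → ‖(chi A).comp (T.comp (chi B))‖ < ε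

end Operators

/-- The Roe algebra `C*(X)` (with coefficients in `H`): the norm closure of the locally compact
operators of finite propagation on `ℓ²(X; H)`. -/
def roeAlgebra (X H : Type*) [MetricSpace X] [NormedAddCommGroup H] [InnerProductSpace ℂ H] :
    Set (Ell2 X H →L[ℂ] Ell2 X H) :=
  closure {T | FinitePropagation T ∧ LocallyCompactOp T}

/-- The uniform Roe algebra `C*_u(X)`: the norm closure of the operators of finite propagation
on `ℓ²(X)`. -/
def uniformRoeAlgebra (X : Type*) [MetricSpace X] : Set (Ell2 X ℂ →L[ℂ] Ell2 X ℂ) :=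
  closure {T | FinitePropagation T}

/-! ### Block-rank-one projections -/

section Blocks

variable {X H : Type*} [NormedAddCommGroup H] [InnerProductSpace ℂ H]

/-- `P` is a block-rank-one projection with respect to `(Xₙ)`: an orthogonal projection that is
block diagonal for `ℓ²(X; H) = ⨁ₙ ℓ²(Xₙ; H)` (it commutes with the projections `χ_{Xₙ}` onto the
summands) and whose blocks `Pₙ = P χ_{Xₙ}` all have rank one. -/
structure IsBlockRankOneProjection [CompleteSpace H] (Xn : ℕ → Finset X)
    (P : Ell2 X H →L[ℂ] Ell2 X H) : Prop where
  isStarProjection : IsStarProjection P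
  block_diagonal : ∀ n, P.comp (chi (Xn n : Set X)) = (chi (Xn n : Set X)).comp P
  rank_one : ∀ n, Module.finrank ℂ
    (LinearMap.range (P.comp (chi (Xn n : Set X))).toLinearMap) = 1

/-- The point masses `mₙ(x) = ‖Pₙ δ_x‖²` of the associated probability measures, where `δ_x` acts
as the multiplication operator `χ_{x}` (for `x ∈ Xₙ` we have `Pₙ χ_{x} = P χ_{x}`; for `H = ℂ`
this is the norm squared of the vector `Pₙ δ_x`). -/
def assocMass (Xn : ℕ → Finset X) (P : Ell2 X H →L[ℂ] Ell2 X H) (n : ℕ) (x : Xn n) : ℝ :=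
  ‖P.comp (chi ({(x : X)} : Set X))‖ ^ 2

/-- `P = ⨁ₙ Pₙ` with `Pₙ η = ⟨η, ξₙ⟩ ξₙ` for `η ∈ ℓ²(Xₙ; H)`, where each `ξₙ` is a unit vector in
`ℓ²(Xₙ; H)` (a vector of `ℓ²(X; H)` supported in `Xₙ`). The inner product of Mathlib is linear in
its second argument. -/
structure IsAssociatedTo (Xn : ℕ → Finset X) (P : Ell2 X H →L[ℂ] Ell2 X H)
    (ξ : ℕ → Ell2 X H) : Prop where
  norm_eq_one : ∀ n, ‖ξ n‖ = 1
  support : ∀ n, ∀ x ∉ Xn n, ξ n x = 0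
  apply_block : ∀ (n : ℕ) (η : Ell2 X H), (∀ x ∉ Xn n, η x = 0) → P η = ⟪ξ n, η⟫_ℂ • ξ n

/-- The uniformization of a vector: `x ↦ ‖ξ(x)‖` in `ℓ²(X)`. -/
def uniformVec (ξ : Ell2 X H) : Ell2 X ℂ :=
  ⟨fun x => ((‖ξ x‖ : ℝ) : ℂ), memℓp_norm ξ⟩

/-- `Q` on `ℓ²(X)` is the uniformization of the block-rank-one projection `P` on `ℓ²(X; H)`:
`Q` is associated to the uniformizations of unit vectors to which `P` is associated. -/
def IsUniformization (Xn : ℕ → Finset X) (P : Ell2 X H →L[ℂ] Ell2 X H)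
    (Q : Ell2 X ℂ →L[ℂ] Ell2 X ℂ) : Prop :=
  ∃ ξ : ℕ → Ell2 X H, IsAssociatedTo Xn P ξ ∧ IsAssociatedTo Xn Q fun n => uniformVec (ξ n)

end Blocks

end

end RoeBlock

namespace RoeBlock

/-! ### Vectors and operators on `ℓ²(X; H)` -/

section Vectors

variable {X H : Type*} [NormedAddCommGroup H]

/-! On the block `Xn n` the projection is `η ↦ ⟪ξ n, η⟫ • ξ n`, so the block of `χ_A P χ_B` has norm
`√(m_n(A) m_n(B))`. Quasi-locality therefore says that two sets far apart cannot both have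
substantial measure, uniformly in `n`. This is asymptotic expansion in another form. If a set had
small boundary, it and the complement of its neighbourhood would be far apart and both large.
Conversely, iterating expansion makes the neighbourhoods of two substantial sets exceed measure
`1/2`, so they meet. This is `IsAssociatedTo.quasiLocal_iff`; it involves only the numbers `‖ξ n
x‖`, hence does not distinguish `P` from its uniformization.

Norm limits of finite propagation operators are quasi-local (`quasiLocal_of_mem_closure`). The
substantial converse is that expansion puts the uniformization in the uniform Roe algebra. Give
pairs at distance at most `R` the weight `min (m x) (m y)`. Bounded geometry turns expansion in
measure into a lower bound on edge flow (`Expands.le_flow`), and discarding a set of small measure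
leaves `Y` with a genuine Cheeger constant (`exists_expanding_subset`). Cheeger's inequality
(`poincare`) gives the lazy walk on `Y` a spectral gap, so its powers, which have finite
propagation, converge in norm to the rank-one projection of `Y` (`norm_walk_sub_proj_le`). That
projection is close to the one of the whole block (`norm_proj_sub_rankOne_le`). All constants are
uniform in `n`, so the blocks can be summed.

To return to coefficients in `H`, write `ξ n x = ‖ξ n x‖ • u x`. Then `P` is its uniformization
conjugated by the multiplication operator `ampl u` and its adjoint `coampl u`. This conjugation is
contractive, preserves propagation and makes matrix entries of rank at most one
(`mem_roeAlgebra_of_uniformization`). -/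

theorem hasSum_norm_sq (f : Ell2 X H) : HasSum (fun x => ‖f x‖ ^ 2) (‖f‖ ^ 2) := by
  have h := lp.hasSum_norm (p := 2) (by norm_num) f
  simpa using h

theorem sum_norm_sq_le (f : Ell2 X H) (s : Finset X) : ∑ x ∈ s, ‖f x‖ ^ 2 ≤ ‖f‖ ^ 2 :=
  sum_le_hasSum s (fun _ _ => sq_nonneg _) (hasSum_norm_sq f)

theorem norm_sq_eq_sum {f : Ell2 X H} {s : Finset X} (h : ∀ x ∉ s, f x = 0) :
    ‖f‖ ^ 2 = ∑ x ∈ s, ‖f x‖ ^ 2 :=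
  (hasSum_norm_sq f).unique (hasSum_sum_of_ne_finset_zero fun x hx => by simp [h x hx])

theorem memℓp_two_of_sum_le {g : X → H} {C : ℝ} (h : ∀ s : Finset X, ∑ x ∈ s, ‖g x‖ ^ 2 ≤ C) :
    Memℓp g 2 :=
  memℓp_gen' (C := C) fun s => by simpa using h s

theorem norm_le_of_sum_sq_le {f : Ell2 X H} {C : ℝ} (hC : 0 ≤ C)
    (h : ∀ s : Finset X, ∑ x ∈ s, ‖f x‖ ^ 2 ≤ C ^ 2) : ‖f‖ ≤ C :=
  lp.norm_le_of_forall_sum_le (p := 2) (by norm_num) hC fun s => by simpa using h s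

/-- A finite set meets only finitely many blocks, and these are disjoint. Since `g` is a bare
function, the bound serves both to show square-summability and to estimate norms. -/
theorem sum_norm_sq_le_of_blocks {K : Type*} [NormedAddCommGroup K] {Xn : ℕ → Finset X}
    (hd : Pairwise fun n m => Disjoint (Xn n) (Xn m))
    (hc : ∀ x : X, ∃ n, x ∈ Xn n) {g : X → K} {η : Ell2 X H} {C : ℝ}
    (h : ∀ n, ∑ x ∈ Xn n, ‖g x‖ ^ 2 ≤ C ^ 2 * ∑ x ∈ Xn n, ‖η x‖ ^ 2) (s : Finset X) :
    ∑ x ∈ s, ‖g x‖ ^ 2 ≤ (C * ‖η‖) ^ 2 := by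
  classical
  choose ν hν using hc
  let t := s.image ν
  have hst : s ⊆ t.biUnion Xn := fun x hx =>
    Finset.mem_biUnion.2 ⟨ν x, Finset.mem_image_of_mem ν hx, hν x⟩
  have hdt : (t : Set ℕ).PairwiseDisjoint Xn := fun a _ b _ hab => hd hab
  calc ∑ x ∈ s, ‖g x‖ ^ 2 ≤ ∑ x ∈ t.biUnion Xn, ‖g x‖ ^ 2 :=
        Finset.sum_le_sum_of_subset_of_nonneg hst fun _ _ _ => sq_nonneg _
    _ = ∑ n ∈ t, ∑ x ∈ Xn n, ‖g x‖ ^ 2 := Finset.sum_biUnion hdt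
    _ ≤ ∑ n ∈ t, C ^ 2 * ∑ x ∈ Xn n, ‖η x‖ ^ 2 := Finset.sum_le_sum fun n _ => h n
    _ = C ^ 2 * ∑ x ∈ t.biUnion Xn, ‖η x‖ ^ 2 := by
        rw [← Finset.mul_sum, Finset.sum_biUnion hdt]
    _ ≤ C ^ 2 * ‖η‖ ^ 2 := mul_le_mul_of_nonneg_left (sum_norm_sq_le η _) (sq_nonneg _)
    _ = (C * ‖η‖) ^ 2 := by ring

end Vectors

section Operators

variable {X H K : Type*} [NormedAddCommGroup H] [InnerProductSpace ℂ H]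
  [NormedAddCommGroup K] [InnerProductSpace ℂ K]

theorem chi_apply (A : Set X) (f : Ell2 X H) (x : X) : chi A f x = A.indicator (⇑f) x := rfl

theorem chi_apply_of_mem {A : Set X} {x : X} (h : x ∈ A) (f : Ell2 X H) : chi A f x = f x := by
  rw [chi_apply, Set.indicator_of_mem h]

theorem chi_apply_of_notMem {A : Set X} {x : X} (h : x ∉ A) (f : Ell2 X H) :
    chi A f x = 0 := by
  rw [chi_apply, Set.indicator_of_notMem h]

theorem norm_chi_apply_le (A : Set X) (f : Ell2 X H) : ‖chi A f‖ ≤ ‖f‖ :=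
  lp.norm_mono (by norm_num) fun _ => norm_indicator_le_norm_self _ _

theorem norm_chi_comp_comp_chi_le (A B : Set X) (T : Ell2 X H →L[ℂ] Ell2 X H) :
    ‖(chi A).comp (T.comp (chi B))‖ ≤ ‖T‖ :=
  ContinuousLinearMap.opNorm_le_bound _ (norm_nonneg T) fun f =>
    (norm_chi_apply_le A _).trans ((T.le_opNorm _).trans
      (mul_le_mul_of_nonneg_left (norm_chi_apply_le B f) (norm_nonneg T)))

theorem chi_eq_self {A : Set X} {f : Ell2 X H} (h : ∀ x ∉ A, f x = 0) : chi A f = f := by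
  refine lp.ext (funext fun x => ?_)
  by_cases hx : x ∈ A
  · exact chi_apply_of_mem hx f
  · rw [chi_apply_of_notMem hx, h x hx]

/-- Continuous linear maps on `ℓ²(X; H)` agreeing on vectors supported in the blocks of a
cover agree. -/
theorem ext_of_blocks {Xn : ℕ → Finset X} (hc : ∀ x : X, ∃ n, x ∈ Xn n)
    {S T : Ell2 X H →L[ℂ] Ell2 X K}
    (h : ∀ n, ∀ η : Ell2 X H, (∀ x ∉ Xn n, η x = 0) → S η = T η) : S = T := by
  classical
  refine lp.ext_continuousLinearMap (p := 2) (by norm_num) fun x => ?_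
  obtain ⟨n, hn⟩ := hc x
  refine ContinuousLinearMap.ext fun v => h n _ fun y hy => ?_
  have hyx : y ≠ x := fun e => hy (e ▸ hn)
  simp [lp.singleContinuousLinearMap_apply, hyx]

/-! ### Propagation -/

section Propagation

variable [MetricSpace X]

/-- `(T η)(x)` vanishes as soon as `η` vanishes on the ball of radius `R` around `x`. -/
def PropagationLE (T : Ell2 X H →L[ℂ] Ell2 X K) (R : ℝ) : Prop :=
  ∀ (η : Ell2 X H) (x : X), (∀ y, dist x y ≤ R → η y = 0) → T η x = 0

theorem PropagationLE.mul {S T : Ell2 X H →L[ℂ] Ell2 X H} {R R' : ℝ}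
    (hS : PropagationLE S R) (hT : PropagationLE T R') : PropagationLE (S * T) (R + R') :=
  fun η x hx => hS (T η) x fun y hy => hT η y fun z hz => hx z
    ((dist_triangle x y z).trans (add_le_add hy hz))

theorem PropagationLE.pow {T : Ell2 X H →L[ℂ] Ell2 X H} {R : ℝ}
    (hT : PropagationLE T R) (k : ℕ) : PropagationLE (T ^ k) (k * R) := by
  induction k with
  | zero =>
    intro η x hx
    simpa using hx x (by simp)
  | succ k ih =>
    rw [pow_succ]
    have := ih.mul hT
    push_cast
    rwa [add_mul, one_mul]

theorem PropagationLE.finitePropagation {T : Ell2 X H →L[ℂ] Ell2 X H} {R : ℝ}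
    (hT : PropagationLE T R) : FinitePropagation T := by
  classical
  refine ⟨R, fun x y hxy => ?_⟩
  by_contra hlt
  refine hxy (ContinuousLinearMap.ext fun v => ?_)
  refine hT _ x fun z hz => ?_
  have hzy : z ≠ y := fun e => hlt (e ▸ hz)
  simp [lp.singleContinuousLinearMap_apply, hzy]

/-- Expanding `η` in its coordinates, every term of `(T η)(x)` vanishes, because either `η y` or the
entry at `(x, y)` does. The resulting pointwise condition composes directly, with no matrix
products. -/
theorem FinitePropagation.exists_propagationLE {T : Ell2 X H →L[ℂ] Ell2 X H}
    (hT : FinitePropagation T) : ∃ R, PropagationLE T R := by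
  classical
  obtain ⟨R, hR⟩ := hT
  refine ⟨R, fun η x hx => ?_⟩
  have h1 := lp.hasSum_single (p := 2) (by norm_num) η
  have h2 := h1.mapL ((lp.evalCLM ℂ (fun _ : X => H) 2 x).comp T)
  refine h2.unique ?_
  have hz : ∀ y, ((lp.evalCLM ℂ (fun _ : X => H) 2 x).comp T) (lp.single 2 y (η y)) = 0 := ?_
  · simpa only [hz] using hasSum_zero
  intro y
  by_cases hy : dist x y ≤ R
  · simp [hx y hy]
  · have : entry T x y = 0 := by
      by_contra hne
      exact hy (hR x y hne)
    have h3 := DFunLike.congr_fun this (η y)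
    simp only [entry, ContinuousLinearMap.comp_apply, lp.singleContinuousLinearMap_apply] at h3
    exact h3

theorem lt_dist_of_lt_setEDist {A B : Set X} {R : ℝ} (h : ENNReal.ofReal R < setEDist A B)
    {a b : X} (ha : a ∈ A) (hb : b ∈ B) : R < dist a b := by
  have h1 : setEDist A B ≤ edist a b := (iInf₂_le a ha).trans (iInf₂_le b hb)
  have h2 := h.trans_le h1
  rw [edist_dist] at h2
  exact lt_of_not_ge fun hle => absurd (ENNReal.ofReal_le_ofReal hle) (not_le.2 h2)

theorem lt_setEDist {A B : Set X} {R R' : ℝ} (hR : 0 ≤ R) (hRR' : R < R')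
    (h : ∀ a ∈ A, ∀ b ∈ B, R' ≤ dist a b) : ENNReal.ofReal R < setEDist A B := by
  refine ((ENNReal.ofReal_lt_ofReal_iff (hR.trans_lt hRR')).2 hRR').trans_le ?_
  refine le_iInf₂ fun a ha => le_iInf₂ fun b hb => ?_
  rw [edist_dist]
  exact ENNReal.ofReal_le_ofReal (h a ha b hb)

/-- If `S` has propagation `R`, then `χ_A S χ_B = 0` for `A`, `B` more than `R` apart, so only the
approximation error `T - S` survives the compression. -/
theorem quasiLocal_of_mem_closure {T : Ell2 X H →L[ℂ] Ell2 X H}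
    (hT : T ∈ closure {T : Ell2 X H →L[ℂ] Ell2 X H | FinitePropagation T}) : QuasiLocal T := by
  intro ε hε
  obtain ⟨S, hS, hTS⟩ := (Metric.mem_closure_iff (α := Ell2 X H →L[ℂ] Ell2 X H)).1 hT ε hε
  obtain ⟨R, hR⟩ := FinitePropagation.exists_propagationLE hS
  refine ⟨max R 1, by positivity, fun A B hAB => ?_⟩
  have hzero : (chi A).comp (S.comp (chi B)) = 0 := by
    refine ContinuousLinearMap.ext fun η => lp.ext (funext fun x => ?_)
    by_cases hx : x ∈ A
    · refine (chi_apply_of_mem hx _).trans (hR _ x fun y hy => chi_apply_of_notMem (fun hyB => ?_) _)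
      have := lt_dist_of_lt_setEDist hAB hx hyB
      exact absurd hy (not_le.2 ((le_max_left _ _).trans_lt this))
    · exact chi_apply_of_notMem hx _
  have : (chi A).comp (T.comp (chi B)) = (chi A).comp ((T - S).comp (chi B)) := by
    rw [ContinuousLinearMap.sub_comp, ContinuousLinearMap.comp_sub, hzero, sub_zero]
  rw [this]
  refine (norm_chi_comp_comp_chi_le A B _).trans_lt ?_
  exact lt_of_eq_of_lt (dist_eq_norm T S).symm hTS

end Propagation

/-! ### Blockwise estimates -/

section BlockEstimates

variable {Xn : ℕ → Finset X}

/-- An operator on `ℓ²(X; H)` whose restrictions to the blocks have norm at most `C` and act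
blockwise has norm at most `C`. -/
theorem opNorm_le_of_blocks (hd : Pairwise fun n m => Disjoint (Xn n) (Xn m))
    (hc : ∀ x : X, ∃ n, x ∈ Xn n) {T : Ell2 X H →L[ℂ] Ell2 X K} {C : ℝ} (hC : 0 ≤ C)
    (h : ∀ n (η : Ell2 X H), ∑ x ∈ Xn n, ‖T η x‖ ^ 2 ≤ C ^ 2 * ∑ x ∈ Xn n, ‖η x‖ ^ 2) :
    ‖T‖ ≤ C :=
  ContinuousLinearMap.opNorm_le_bound _ hC fun η =>
    norm_le_of_sum_sq_le (by positivity)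
      (sum_norm_sq_le_of_blocks hd hc fun n => h n η)

theorem sum_norm_sq_chi (s : Finset X) (η : Ell2 X H) :
    ‖chi (s : Set X) η‖ ^ 2 = ∑ x ∈ s, ‖η x‖ ^ 2 := by
  rw [norm_sq_eq_sum (s := s) fun x hx => chi_apply_of_notMem (by simpa using hx) η]
  exact Finset.sum_congr rfl fun x hx => by rw [chi_apply_of_mem (by simpa using hx)]

/-- The direct sum of a uniformly bounded sequence of operators on the blocks. -/
theorem exists_directSum (hd : Pairwise fun n m => Disjoint (Xn n) (Xn m))
    (hc : ∀ x : X, ∃ n, x ∈ Xn n) (D : ℕ → Ell2 X H →L[ℂ] Ell2 X K) {C : ℝ} (hC : 0 ≤ C)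
    (hD : ∀ n, ‖D n‖ ≤ C) : ∃ T : Ell2 X H →L[ℂ] Ell2 X K, ‖T‖ ≤ C ∧
      ∀ n (η : Ell2 X H), ∀ x ∈ Xn n, T η x = D n (chi (Xn n : Set X) η) x := by
  choose ν hν using hc
  have huniq : ∀ n, ∀ x ∈ Xn n, ν x = n := fun n x hx => by
    by_contra hne
    exact Finset.disjoint_left.1 (hd hne) (hν x) hx
  let g : Ell2 X H → X → K := fun η x => D (ν x) (chi (Xn (ν x) : Set X) η) x
  have hg : ∀ η s, ∑ x ∈ s, ‖g η x‖ ^ 2 ≤ (C * ‖η‖) ^ 2 := by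
    intro η
    refine sum_norm_sq_le_of_blocks hd (fun x => ⟨ν x, hν x⟩) fun n => ?_
    calc ∑ x ∈ Xn n, ‖g η x‖ ^ 2 = ∑ x ∈ Xn n, ‖D n (chi (Xn n : Set X) η) x‖ ^ 2 :=
          Finset.sum_congr rfl fun x hx => by simp only [g, huniq n x hx]
      _ ≤ ‖D n (chi (Xn n : Set X) η)‖ ^ 2 := sum_norm_sq_le _ _
      _ ≤ (C * ‖chi (Xn n : Set X) η‖) ^ 2 := by
          gcongr
          exact (D n).le_of_opNorm_le (hD n) _
      _ = C ^ 2 * ∑ x ∈ Xn n, ‖η x‖ ^ 2 := by rw [mul_pow, sum_norm_sq_chi]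
  let T₀ : Ell2 X H →ₗ[ℂ] Ell2 X K :=
    { toFun := fun η => ⟨g η, memℓp_two_of_sum_le (hg η)⟩
      map_add' := fun η θ => Subtype.ext (funext fun x => by simp [g]; rfl)
      map_smul' := fun c η => Subtype.ext (funext fun x => by simp [g]) }
  have hT₀ : ∀ η, ‖T₀ η‖ ≤ C * ‖η‖ := fun η => norm_le_of_sum_sq_le (by positivity) (hg η)
  refine ⟨T₀.mkContinuous C hT₀, T₀.mkContinuous_norm_le hC hT₀, fun n η x hx => ?_⟩
  change g η x = _
  simp only [g, huniq n x hx]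

end BlockEstimates

/-! ### The operators implementing a change of coefficients -/

section Coefficients

/-- The operator `f ↦ (x ↦ f(x) u(x))` from `ℓ²(X)` to `ℓ²(X; H)`. -/
noncomputable def ampl (u : X → H) (hu : ∀ x, ‖u x‖ ≤ 1) : Ell2 X ℂ →L[ℂ] Ell2 X H :=
  LinearMap.mkContinuous
    { toFun := fun f => ⟨fun x => f x • u x, (lp.memℓp f).mono' fun x => by
        rw [norm_smul]; exact mul_le_of_le_one_right (norm_nonneg _) (hu x)⟩
      map_add' := fun f g => Subtype.ext (funext fun x => by simp [add_smul]; rfl)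
      map_smul' := fun c f => Subtype.ext (funext fun x => by simp [mul_smul]) }
    1 fun f => by
      rw [one_mul]
      refine lp.norm_mono (by norm_num) fun x => ?_
      change ‖f x • u x‖ ≤ _
      rw [norm_smul]; exact mul_le_of_le_one_right (norm_nonneg _) (hu x)

/-- The operator `g ↦ (x ↦ ⟪u(x), g(x)⟫)` from `ℓ²(X; H)` to `ℓ²(X)`. -/
noncomputable def coampl (u : X → H) (hu : ∀ x, ‖u x‖ ≤ 1) : Ell2 X H →L[ℂ] Ell2 X ℂ :=
  LinearMap.mkContinuous
    { toFun := fun g => ⟨fun x => ⟪u x, g x⟫_ℂ, (lp.memℓp g).mono' fun x =>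
        (norm_inner_le_norm _ _).trans (mul_le_of_le_one_left (norm_nonneg _) (hu x))⟩
      map_add' := fun f g => Subtype.ext (funext fun x => by simp; rfl)
      map_smul' := fun c f => Subtype.ext (funext fun x => by simp) }
    1 fun g => by
      rw [one_mul]
      refine lp.norm_mono (by norm_num) fun x => ?_
      exact (norm_inner_le_norm _ _).trans (mul_le_of_le_one_left (norm_nonneg _) (hu x))

variable {u : X → H} (hu : ∀ x, ‖u x‖ ≤ 1)

theorem ampl_apply (f : Ell2 X ℂ) (x : X) : ampl u hu f x = f x • u x := rfl

theorem coampl_apply (g : Ell2 X H) (x : X) : coampl u hu g x = ⟪u x, g x⟫_ℂ := rfl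

theorem norm_ampl_le : ‖ampl u hu‖ ≤ 1 := LinearMap.mkContinuous_norm_le _ zero_le_one _

theorem norm_coampl_le : ‖coampl u hu‖ ≤ 1 := LinearMap.mkContinuous_norm_le _ zero_le_one _

theorem norm_ampl_comp_comp_coampl_le (T : Ell2 X ℂ →L[ℂ] Ell2 X ℂ) :
    ‖(ampl u hu).comp (T.comp (coampl u hu))‖ ≤ ‖T‖ := by
  refine (ContinuousLinearMap.opNorm_comp_le _ _).trans ?_
  refine (mul_le_mul (norm_ampl_le hu) (ContinuousLinearMap.opNorm_comp_le _ _)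
    (norm_nonneg _) zero_le_one).trans ?_
  rw [one_mul]
  exact mul_le_of_le_one_right (norm_nonneg _) (norm_coampl_le hu)

theorem PropagationLE.ampl_comp_comp_coampl [MetricSpace X] {T : Ell2 X ℂ →L[ℂ] Ell2 X ℂ} {R : ℝ}
    (hT : PropagationLE T R) : PropagationLE ((ampl u hu).comp (T.comp (coampl u hu))) R := by
  intro η x hx
  have : T (coampl u hu η) x = 0 := hT _ x fun y hy => by simp [coampl_apply, hx y hy]
  change T (coampl u hu η) x • u x = 0
  rw [this, zero_smul]

/-- Every matrix entry factors through `ℂ`: a functional on `H` followed by `c ↦ c • u x`. -/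
theorem locallyCompactOp_ampl_comp_comp_coampl (T : Ell2 X ℂ →L[ℂ] Ell2 X ℂ) :
    LocallyCompactOp ((ampl u hu).comp (T.comp (coampl u hu))) := by
  intro x y
  have hid : IsCompactOperator (ContinuousLinearMap.id ℂ ℂ) :=
    ⟨Metric.closedBall 0 1, isCompact_closedBall _ _, by
      simpa using Metric.closedBall_mem_nhds (0 : ℂ) one_pos⟩
  let ψ : H →L[ℂ] ℂ := (lp.evalCLM ℂ (fun _ : X => ℂ) 2 x).comp
    (T.comp ((coampl u hu).comp (by
      classical exact lp.singleContinuousLinearMap ℂ (fun _ : X => H) 2 y)))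
  have h : IsCompactOperator
      ((ContinuousLinearMap.toSpanSingleton ℂ (u x)).comp
        ((ContinuousLinearMap.id ℂ ℂ).comp ψ)) := by
    exact (hid.comp_clm ψ).clm_comp (ContinuousLinearMap.toSpanSingleton ℂ (u x))
  exact h

end Coefficients

end Operators

/-! ### Block-rank-one projections and their unit vectors -/

section BlockRankOne

theorem uniformVec_apply {X H : Type*} [NormedAddCommGroup H] (ξ : Ell2 X H) (x : X) : uniformVec ξ x = ((‖ξ x‖ : ℝ) : ℂ) := rfl

theorem norm_uniformVec {X H : Type*} [NormedAddCommGroup H] (ξ : Ell2 X H) : ‖uniformVec ξ‖ = ‖ξ‖ := by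
  rw [← sq_eq_sq₀ (norm_nonneg _) (norm_nonneg _)]
  refine (hasSum_norm_sq _).unique ?_
  simpa [uniformVec_apply] using hasSum_norm_sq ξ

variable {X H : Type*} [NormedAddCommGroup H] [InnerProductSpace ℂ H]

theorem inner_eq_sum {ξ : Ell2 X H} {s : Finset X} (h : ∀ x ∉ s, ξ x = 0) (η : Ell2 X H) :
    ⟪ξ, η⟫_ℂ = ∑ x ∈ s, ⟪ξ x, η x⟫_ℂ :=
  (lp.hasSum_inner ξ η).unique (hasSum_sum_of_ne_finset_zero fun x hx => by simp [h x hx])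

theorem inner_chi {ξ : Ell2 X H} {s : Finset X} (h : ∀ x ∉ s, ξ x = 0) (η : Ell2 X H) :
    ⟪ξ, chi (s : Set X) η⟫_ℂ = ⟪ξ, η⟫_ℂ := by
  rw [inner_eq_sum h, inner_eq_sum h]
  exact Finset.sum_congr rfl fun x hx => by rw [chi_apply_of_mem (by simpa using hx)]

/-- Normalise a vector `v` spanning the range of the block. Commutation with `χ` puts its support in
the block, and self-adjointness fixes the coefficient in `P η = c • v`: `⟪v, η⟫ = ⟪P v, η⟫ = ⟪v, P
η⟫ = c ‖v‖²`. -/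
theorem IsBlockRankOneProjection.exists_isAssociatedTo [CompleteSpace H] {Xn : ℕ → Finset X}
    {P : Ell2 X H →L[ℂ] Ell2 X H} (hP : IsBlockRankOneProjection Xn P) :
    ∃ ξ, IsAssociatedTo Xn P ξ := by
  have key : ∀ n, ∃ ξ : Ell2 X H, ‖ξ‖ = 1 ∧ (∀ x ∉ Xn n, ξ x = 0) ∧
      ∀ η : Ell2 X H, (∀ x ∉ Xn n, η x = 0) → P η = ⟪ξ, η⟫_ℂ • ξ := by
    intro n
    obtain ⟨⟨v, hv⟩, hv0, hspan⟩ := finrank_eq_one_iff'.1 (hP.rank_one n)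
    have hv0' : v ≠ 0 := fun h => hv0 (Subtype.ext h)
    have hspan' : ∀ η : Ell2 X H, (∀ x ∉ Xn n, η x = 0) → ∃ c : ℂ, c • v = P η := by
      intro η hη
      obtain ⟨c, hc⟩ := hspan ⟨P η, η, by
        change P (chi (Xn n : Set X) η) = P η
        rw [chi_eq_self (by simpa using hη)]⟩
      exact ⟨c, congrArg Subtype.val hc⟩
    obtain ⟨θ, hθ⟩ := hv
    have hPP : ∀ η, P (P η) = P η := fun η =>
      DFunLike.congr_fun hP.isStarProjection.isIdempotentElem η
    have hθ' : P (chi (Xn n : Set X) θ) = v := hθ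
    have hPv : P v = v := by rw [← hθ', hPP]
    have hvs : ∀ x ∉ Xn n, v x = 0 := by
      intro x hx
      have := DFunLike.congr_fun (hP.block_diagonal n) θ
      have h2 : v = chi (Xn n : Set X) (P θ) := hθ'.symm.trans this
      rw [h2, chi_apply_of_notMem (by simpa using hx)]
    have hsymm : ∀ η θ : Ell2 X H, ⟪P η, θ⟫_ℂ = ⟪η, P θ⟫_ℂ := fun η θ => by
      have hsa := hP.isStarProjection.isSelfAdjoint
      rw [← ContinuousLinearMap.adjoint_inner_right, hsa.adjoint_eq]
    have hnv : (‖v‖ : ℂ) ≠ 0 := by simpa using hv0'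
    refine ⟨((‖v‖ : ℂ)⁻¹) • v, ?_, fun x hx => ?_, fun η hη => ?_⟩
    · rw [norm_smul, norm_inv, Complex.norm_real, norm_norm, inv_mul_cancel₀ (norm_ne_zero_iff.2 hv0')]
    · simp [hvs x hx]
    · obtain ⟨c, hc⟩ := hspan' η hη
      have h1 : ⟪v, η⟫_ℂ = c * (‖v‖ : ℂ) ^ 2 := by
        have h2 := hsymm v η
        rw [hPv, ← hc, inner_smul_right, inner_self_eq_norm_sq_to_K] at h2
        exact h2
      rw [inner_smul_left, h1, ← hc, smul_smul]
      congr 1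
      rw [map_inv₀, Complex.conj_ofReal]
      field_simp
  choose ξ h1 h2 h3 using key
  exact ⟨ξ, h1, h2, h3⟩

section Associated

variable {Xn : ℕ → Finset X} {P : Ell2 X H →L[ℂ] Ell2 X H} {ξ : ℕ → Ell2 X H}

theorem IsAssociatedTo.sum_norm_sq (h : IsAssociatedTo Xn P ξ) (n : ℕ) :
    ∑ x ∈ Xn n, ‖ξ n x‖ ^ 2 = 1 := by
  rw [← norm_sq_eq_sum (h.support n), h.norm_eq_one, one_pow]

/-- The definition describes `P` only on vectors supported in a single block. As `P` maps each such
vector into its own block, it commutes with every `χ_{Xn n}`, and a general `η` may be cut down to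
the block of `x`. -/
theorem IsAssociatedTo.apply_of_mem (h : IsAssociatedTo Xn P ξ)
    (hd : Pairwise fun n m => Disjoint (Xn n) (Xn m)) (hc : ∀ x : X, ∃ n, x ∈ Xn n)
    (η : Ell2 X H) {n : ℕ} {x : X} (hx : x ∈ Xn n) : P η x = ⟪ξ n, η⟫_ℂ • ξ n x := by
  have hcomm : (chi (Xn n : Set X)).comp P = P.comp (chi (Xn n : Set X)) := by
    refine ext_of_blocks hc fun m η hη => ?_
    change chi (Xn n : Set X) (P η) = P (chi (Xn n : Set X) η)
    by_cases hmn : m = n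
    · subst hmn
      rw [chi_eq_self (f := η) (by simpa using hη), chi_eq_self]
      intro y hy
      rw [h.apply_block m η hη, lp.coeFn_smul, Pi.smul_apply, h.support m y (by simpa using hy),
        smul_zero]
    · have hdis := hd hmn
      have h0 : chi (Xn n : Set X) η = 0 := by
        refine lp.ext (funext fun y => ?_)
        by_cases hy : y ∈ Xn n
        · rw [chi_apply_of_mem (by simpa using hy), hη y (Finset.disjoint_right.1 hdis hy)]; rfl
        · exact chi_apply_of_notMem (by simpa using hy) _
      rw [h0, map_zero]
      refine lp.ext (funext fun y => ?_)
      by_cases hy : y ∈ Xn n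
      · rw [chi_apply_of_mem (by simpa using hy), h.apply_block m η hη, lp.coeFn_smul,
          Pi.smul_apply, h.support m y (Finset.disjoint_right.1 hdis hy), smul_zero]; rfl
      · exact chi_apply_of_notMem (by simpa using hy) _
  have h1 : P η x = chi (Xn n : Set X) (P η) x := (chi_apply_of_mem (by simpa using hx) _).symm
  have h2 : chi (Xn n : Set X) (P η) = P (chi (Xn n : Set X) η) := DFunLike.congr_fun hcomm η
  rw [h1, h2, h.apply_block n _ fun y hy => chi_apply_of_notMem (by simpa using hy) _,
    inner_chi (h.support n)]
  rfl

/-- `P χ_{x}` is the rank-one operator `η ↦ ⟪ξ n x, η x⟫ • ξ n`. Cauchy–Schwarz bounds its norm, and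
testing on `χ_{x} (ξ n)` attains the bound. -/
theorem IsAssociatedTo.assocMass_eq (h : IsAssociatedTo Xn P ξ) (n : ℕ) (x : Xn n) :
    assocMass Xn P n x = ‖ξ n x‖ ^ 2 := by
  set T := P.comp (chi ({(x : X)} : Set X)) with hT
  have hsupp : ∀ η : Ell2 X H, ∀ y ∉ ({(x : X)} : Finset X), chi ({(x : X)} : Set X) η y = 0 :=
    fun η y hy => chi_apply_of_notMem (by simpa using hy) η
  have happ : ∀ η : Ell2 X H, T η = ⟪ξ n x, η x⟫_ℂ • ξ n := by
    intro η
    have h1 : T η = ⟪ξ n, chi ({(x : X)} : Set X) η⟫_ℂ • ξ n := h.apply_block n _ fun y hy =>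
      chi_apply_of_notMem (fun e => hy (by rw [Set.mem_singleton_iff.1 e]; exact x.2)) _
    rw [h1, ← inner_conj_symm, inner_eq_sum (hsupp η), Finset.sum_singleton, inner_conj_symm,
      chi_apply_of_mem (Set.mem_singleton _)]
  have hnorm : ∀ η : Ell2 X H, ‖T η‖ = ‖⟪ξ n x, η x⟫_ℂ‖ := fun η => by
    rw [happ, norm_smul, h.norm_eq_one, mul_one]
  have hle : ‖T‖ ≤ ‖ξ n x‖ := ContinuousLinearMap.opNorm_le_bound _ (norm_nonneg _) fun η => by
    rw [hnorm]
    exact (norm_inner_le_norm _ _).trans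
      (mul_le_mul_of_nonneg_left (lp.norm_apply_le_norm (by norm_num) η _) (norm_nonneg _))
  have hge : ‖ξ n x‖ ≤ ‖T‖ := by
    rcases (norm_nonneg (ξ n x)).eq_or_lt with h0 | h0
    · rw [← h0]; exact norm_nonneg T
    · have h1 := T.le_opNorm (chi ({(x : X)} : Set X) (ξ n))
      have h2 : ‖chi ({(x : X)} : Set X) (ξ n)‖ ^ 2 = ‖ξ n x‖ ^ 2 := by
        rw [norm_sq_eq_sum (hsupp _), Finset.sum_singleton, chi_apply_of_mem (Set.mem_singleton _)]
      have h3 : ‖⟪ξ n x, ξ n x⟫_ℂ‖ = ‖ξ n x‖ * ‖ξ n x‖ := by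
        rw [inner_self_eq_norm_sq_to_K]; simp [sq]
      rw [(sq_eq_sq₀ (norm_nonneg _) (norm_nonneg _)).1 h2, hnorm,
        chi_apply_of_mem (Set.mem_singleton _), h3] at h1
      exact le_of_mul_le_mul_right h1 h0
  exact congrArg (· ^ 2) (le_antisymm hle hge)

theorem IsAssociatedTo.eq {P' : Ell2 X H →L[ℂ] Ell2 X H} (hc : ∀ x : X, ∃ n, x ∈ Xn n)
    (h : IsAssociatedTo Xn P ξ) (h' : IsAssociatedTo Xn P' ξ) : P = P' :=
  ext_of_blocks hc fun n η hη => by rw [h.apply_block n η hη, h'.apply_block n η hη]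

/-- Both unit vectors span the range of the same block, so they differ by a scalar of modulus one,
which pointwise norms do not see. -/
theorem IsAssociatedTo.uniformVec_eq {ξ' : ℕ → Ell2 X H}
    (h : IsAssociatedTo Xn P ξ) (h' : IsAssociatedTo Xn P ξ') (n : ℕ) :
    uniformVec (ξ n) = uniformVec (ξ' n) := by
  have h1 : ⟪ξ n, ξ' n⟫_ℂ • ξ n = ξ' n := by
    rw [← h.apply_block n _ (h'.support n), h'.apply_block n _ (h'.support n),
      inner_self_eq_norm_sq_to_K, h'.norm_eq_one]
    simp
  have h2 : ‖⟪ξ n, ξ' n⟫_ℂ‖ = 1 := by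
    have := congrArg norm h1
    rwa [norm_smul, h.norm_eq_one, h'.norm_eq_one, mul_one] at this
  refine lp.ext (funext fun x => ?_)
  rw [uniformVec_apply, uniformVec_apply, ← h1, lp.coeFn_smul, Pi.smul_apply, norm_smul, h2,
    one_mul]

theorem IsUniformization.eq {Q Q' : Ell2 X ℂ →L[ℂ] Ell2 X ℂ} (hc : ∀ x : X, ∃ n, x ∈ Xn n)
    (h : IsUniformization Xn P Q) (h' : IsUniformization Xn P Q') : Q = Q' := by
  obtain ⟨ξ, hξ, hQ⟩ := h
  obtain ⟨ξ', hξ', hQ'⟩ := h'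
  refine hQ.eq hc ?_
  rwa [funext fun n => hξ.uniformVec_eq hξ' n]

/-- The polar decomposition of the vectors of a block-rank-one projection: `ξₙ(x) = ‖ξₙ(x)‖ u(x)`
for a function `u` with values in the unit ball. -/
theorem exists_phase (hd : Pairwise fun n m => Disjoint (Xn n) (Xn m))
    (hc : ∀ x : X, ∃ n, x ∈ Xn n) (ξ : ℕ → Ell2 X H) : ∃ u : X → H, (∀ x, ‖u x‖ ≤ 1) ∧
      ∀ n, ∀ x ∈ Xn n, ((‖ξ n x‖ : ℝ) : ℂ) • u x = ξ n x ∧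
        ⟪u x, ξ n x⟫_ℂ = ((‖ξ n x‖ : ℝ) : ℂ) := by
  choose ν hν using hc
  refine ⟨fun x => ((‖ξ (ν x) x‖ : ℂ)⁻¹) • ξ (ν x) x, fun x => ?_, fun n x hx => ?_⟩
  · rw [norm_smul, norm_inv, Complex.norm_real, norm_norm]
    exact inv_mul_le_one
  · have hnx : ν x = n := by
      by_contra hne
      exact Finset.disjoint_left.1 (hd hne) (hν x) hx
    simp only [hnx]
    by_cases h0 : ξ n x = 0
    · simp [h0]
    · have hne : (‖ξ n x‖ : ℂ) ≠ 0 := by simpa using h0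
      refine ⟨by rw [smul_smul, mul_inv_cancel₀ hne, one_smul], ?_⟩
      rw [inner_smul_left, map_inv₀, Complex.conj_ofReal, inner_self_eq_norm_sq_to_K]
      change (‖ξ n x‖ : ℂ)⁻¹ * (‖ξ n x‖ : ℂ) ^ 2 = _
      field_simp

section Phase

variable {u : X → H} (hu : ∀ x, ‖u x‖ ≤ 1)

theorem ampl_uniformVec {ξ : Ell2 X H} (h : ∀ x, ((‖ξ x‖ : ℝ) : ℂ) • u x = ξ x) :
    ampl u hu (uniformVec ξ) = ξ :=
  lp.ext (funext h)

theorem coampl_eq_uniformVec {ξ : Ell2 X H} (h : ∀ x, ⟪u x, ξ x⟫_ℂ = ((‖ξ x‖ : ℝ) : ℂ)) :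
    coampl u hu ξ = uniformVec ξ :=
  lp.ext (funext h)

/-- Stating adjointness through inner products avoids requiring `H` to be complete. -/
theorem inner_ampl (f : Ell2 X ℂ) (η : Ell2 X H) :
    ⟪ampl u hu f, η⟫_ℂ = ⟪f, coampl u hu η⟫_ℂ := by
  refine (lp.hasSum_inner _ _).unique ?_
  have e : (fun x => ⟪ampl u hu f x, η x⟫_ℂ) = fun x => ⟪f x, coampl u hu η x⟫_ℂ :=
    funext fun x => by
      rw [ampl_apply, coampl_apply, inner_smul_left]
      simp [mul_comm]
  have h := lp.hasSum_inner (𝕜 := ℂ) f (coampl u hu η)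
  rwa [← e] at h

theorem inner_coampl (η : Ell2 X H) (f : Ell2 X ℂ) :
    ⟪coampl u hu η, f⟫_ℂ = ⟪η, ampl u hu f⟫_ℂ := by
  rw [← inner_conj_symm, ← inner_ampl, inner_conj_symm]

end Phase

/-- Compressing `P` by the phase operator works: `coampl u` sends `ξ n` to its pointwise norm, and
adjointness moves `ampl u` across the inner product. -/
theorem exists_isUniformization (hd : Pairwise fun n m => Disjoint (Xn n) (Xn m))
    (hc : ∀ x : X, ∃ n, x ∈ Xn n) (h : IsAssociatedTo Xn P ξ) :
    ∃ Q, IsUniformization Xn P Q := by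
  obtain ⟨u, hu, hξ⟩ := exists_phase hd hc ξ
  have h1 : ∀ n x, ((‖ξ n x‖ : ℝ) : ℂ) • u x = ξ n x := fun n x => by
    by_cases hx : x ∈ Xn n
    · exact (hξ n x hx).1
    · simp [h.support n x hx]
  have h2 : ∀ n x, ⟪u x, ξ n x⟫_ℂ = ((‖ξ n x‖ : ℝ) : ℂ) := fun n x => by
    by_cases hx : x ∈ Xn n
    · exact (hξ n x hx).2
    · simp [h.support n x hx]
  refine ⟨(coampl u hu).comp (P.comp (ampl u hu)), ξ, h, ?_, fun n x hx => ?_, fun n η hη => ?_⟩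
  · intro n; rw [norm_uniformVec, h.norm_eq_one]
  · simp [uniformVec_apply, h.support n x hx]
  · change coampl u hu (P (ampl u hu η)) = _
    rw [h.apply_block n _ fun x hx => by simp [ampl_apply, hη x hx], map_smul,
      ← inner_coampl, coampl_eq_uniformVec hu (h2 n)]

/-- A block-rank-one projection is obtained from its uniformization by a change of
coefficients. -/
theorem IsAssociatedTo.exists_eq_ampl_comp_comp_coampl
    (hd : Pairwise fun n m => Disjoint (Xn n) (Xn m)) (hc : ∀ x : X, ∃ n, x ∈ Xn n)
    {Q : Ell2 X ℂ →L[ℂ] Ell2 X ℂ} (h : IsAssociatedTo Xn P ξ)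
    (hQ : IsAssociatedTo Xn Q fun n => uniformVec (ξ n)) :
    ∃ (u : X → H) (hu : ∀ x, ‖u x‖ ≤ 1), P = (ampl u hu).comp (Q.comp (coampl u hu)) := by
  obtain ⟨u, hu, hξ⟩ := exists_phase hd hc ξ
  have h1 : ∀ n x, ((‖ξ n x‖ : ℝ) : ℂ) • u x = ξ n x := fun n x => by
    by_cases hx : x ∈ Xn n
    · exact (hξ n x hx).1
    · simp [h.support n x hx]
  refine ⟨u, hu, ext_of_blocks hc fun n η hη => ?_⟩
  change P η = ampl u hu (Q (coampl u hu η))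
  rw [hQ.apply_block n _ fun x hx => by simp [coampl_apply, hη x hx], map_smul, ← inner_ampl,
    ampl_uniformVec hu (h1 n), h.apply_block n η hη]

/-- Approximants of `Q` are carried to approximants of `P` by the contractive conjugation with `ampl
u` and `coampl u`; local compactness comes from this conjugation and needs nothing from `Q`. -/
theorem mem_roeAlgebra_of_uniformization [MetricSpace X]
    (hd : Pairwise fun n m => Disjoint (Xn n) (Xn m)) (hc : ∀ x : X, ∃ n, x ∈ Xn n)
    {Q : Ell2 X ℂ →L[ℂ] Ell2 X ℂ} (h : IsAssociatedTo Xn P ξ)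
    (hQ : IsAssociatedTo Xn Q fun n => uniformVec (ξ n)) (hQu : Q ∈ uniformRoeAlgebra X) :
    P ∈ roeAlgebra X H := by
  obtain ⟨u, hu, rfl⟩ := h.exists_eq_ampl_comp_comp_coampl hd hc hQ
  refine (Metric.mem_closure_iff (α := Ell2 X H →L[ℂ] Ell2 X H)).2 fun ε hε => ?_
  obtain ⟨S, hS, hQS⟩ := (Metric.mem_closure_iff (α := Ell2 X ℂ →L[ℂ] Ell2 X ℂ)).1 hQu ε hε
  obtain ⟨R, hR⟩ := FinitePropagation.exists_propagationLE hS
  refine ⟨(ampl u hu).comp (S.comp (coampl u hu)),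
    ⟨(hR.ampl_comp_comp_coampl hu).finitePropagation,
      locallyCompactOp_ampl_comp_comp_coampl hu S⟩, ?_⟩
  have hdist := dist_eq_norm ((ampl u hu).comp (Q.comp (coampl u hu)))
    ((ampl u hu).comp (S.comp (coampl u hu)))
  refine lt_of_eq_of_lt hdist ?_
  rw [← ContinuousLinearMap.comp_sub, ← ContinuousLinearMap.sub_comp]
  exact (norm_ampl_comp_comp_coampl_le hu _).trans_lt
    (lt_of_eq_of_lt (dist_eq_norm Q S).symm hQS)

theorem roeAlgebra_subset [MetricSpace X] : roeAlgebra X H ⊆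
    closure {T : Ell2 X H →L[ℂ] Ell2 X H | FinitePropagation T} :=
  closure_mono fun _ hT => hT.1

end Associated

end BlockRankOne

/-! ### Expansion in finite metric spaces -/

section Expansion

theorem mass_restrict {X : Type*} (F : Finset X) (m : X → ℝ) {A : Finset X} (hA : A ⊆ F) :
    mass (fun x : F => m x) {x | (x : X) ∈ A} = ∑ x ∈ A, m x := by
  classical
  have h1 : mass (fun x : F => m x) {x | (x : X) ∈ A} =
      ∑ x : F, (fun y : X => if y ∈ A then m y else 0) x :=
    Finset.sum_congr rfl fun x _ => by simp [Set.indicator_apply]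
  rw [h1, Finset.sum_coe_sort F fun y : X => if y ∈ A then m y else 0, ← Finset.sum_filter,
    Finset.filter_mem_eq_inter, Finset.inter_eq_right.2 hA]

theorem exists_finset_restrict {X : Type*} (F : Finset X) (A : Set F) :
    ∃ B ⊆ F, A = {x : F | (x : X) ∈ B} := by
  classical
  refine ⟨F.filter fun x => ∃ h : x ∈ F, (⟨x, h⟩ : F) ∈ A, Finset.filter_subset _ _, ?_⟩
  ext x
  simp

variable {X : Type*} [MetricSpace X]

open Classical in
/-- The outer `R`-boundary of `A` inside the finite set `F`. -/
noncomputable def bdry (F A : Finset X) (R : ℝ) : Finset X :=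
  F.filter fun x => x ∉ A ∧ ∃ a ∈ A, dist x a ≤ R

open Classical in
/-- The closed `R`-neighbourhood of `A` inside the finite set `F`. -/
noncomputable def nbhd (F A : Finset X) (R : ℝ) : Finset X :=
  F.filter fun x => ∃ a ∈ A, dist x a ≤ R

/-- Subsets of `F` of measure between `α` and `1/2` have `R`-boundaries of proportional measure. -/
def Expands (F : Finset X) (m : X → ℝ) (α c R : ℝ) : Prop :=
  ∀ A ⊆ F, α ≤ ∑ x ∈ A, m x → ∑ x ∈ A, m x ≤ 1 / 2 →
    c * ∑ x ∈ A, m x < ∑ x ∈ bdry F A R, m x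

theorem mem_bdry {F A : Finset X} {R : ℝ} {x : X} :
    x ∈ bdry F A R ↔ x ∈ F ∧ x ∉ A ∧ ∃ a ∈ A, dist x a ≤ R := by
  simp [bdry]

theorem bdry_subset (F A : Finset X) (R : ℝ) : bdry F A R ⊆ F :=
  fun _ hx => (mem_bdry.1 hx).1

theorem mem_nbhd {F A : Finset X} {R : ℝ} {x : X} :
    x ∈ nbhd F A R ↔ x ∈ F ∧ ∃ a ∈ A, dist x a ≤ R := by
  simp [nbhd]

theorem mem_outerBoundary {Y : Type*} [MetricSpace Y] [Finite Y] {R : ℝ} (hR : 0 ≤ R) {A : Set Y}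
    {x : Y} : x ∈ outerBoundary R A ↔ x ∉ A ∧ ∃ a ∈ A, dist x a ≤ R := by
  refine and_congr_right fun _ => ⟨fun h => ?_, fun ⟨a, ha, hxa⟩ => ?_⟩
  · have hne : A.Nonempty := by
      by_contra hne
      rw [Set.not_nonempty_iff_eq_empty.1 hne, Metric.infEDist_empty] at h
      exact absurd h (by simp)
    obtain ⟨a, ha, hxa⟩ := (Set.toFinite A).isCompact.exists_infEDist_eq_edist hne x
    refine ⟨a, ha, ?_⟩
    rw [hxa, edist_dist] at h
    exact (ENNReal.ofReal_le_ofReal_iff hR).1 h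
  · refine (Metric.infEDist_le_edist_of_mem ha).trans ?_
    rw [edist_dist]
    exact ENNReal.ofReal_le_ofReal hxa

theorem outerBoundary_restrict (F : Finset X) {R : ℝ} (hR : 0 ≤ R) {A : Finset X} (hA : A ⊆ F) :
    outerBoundary R {x : F | (x : X) ∈ A} = {x : F | (x : X) ∈ bdry F A R} := by
  ext x
  rw [mem_outerBoundary hR, Set.mem_ofPred_eq, Set.mem_ofPred_eq, mem_bdry]
  refine ⟨fun ⟨h1, a, ha, h2⟩ => ⟨x.2, h1, a, ha, h2⟩, fun ⟨_, h1, a, ha, h2⟩ =>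
    ⟨h1, ⟨a, hA ha⟩, ha, h2⟩⟩

/-- Replaces sets in the subtypes `Xn n` by finsets of `X`, where neighbourhoods and complements
need no coercions. -/
theorem measuredAsymptoticExpanders_iff {Xn : ℕ → Finset X} {m : ℕ → X → ℝ}
    (hm : ∀ n x, 0 ≤ m n x) (hm1 : ∀ n, ∑ x ∈ Xn n, m n x = 1) :
    MeasuredAsymptoticExpanders (fun n => Xn n) (fun n x => m n x) ↔
      ∀ α : ℝ, 0 < α → α ≤ 1 / 2 → ∃ c : ℝ, 0 < c ∧ c < 1 ∧ ∃ R : ℝ, 0 < R ∧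
        ∀ n, Expands (Xn n) (m n) α c R := by
  constructor
  · intro h α h0 h1
    obtain ⟨c, hc0, hc1, R, hR, hexp⟩ := h.expansion α h0 h1
    refine ⟨c, hc0, hc1, R, hR, fun n A hA hA1 hA2 => ?_⟩
    have := hexp n {x | (x : X) ∈ A}
    rw [outerBoundary_restrict _ hR.le hA, mass_restrict _ _ hA,
      mass_restrict _ (m n) (bdry_subset _ _ _)] at this
    exact this hA1 hA2
  · refine fun h => ⟨fun n x => hm n x, fun n => ?_, fun α h0 h1 => ?_⟩
    · rw [← hm1 n, ← mass_restrict (Xn n) (m n) subset_rfl]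
      simp
    · obtain ⟨c, hc0, hc1, R, hR, hexp⟩ := h α h0 h1
      refine ⟨c, hc0, hc1, R, hR, fun n A => ?_⟩
      obtain ⟨B, hB, rfl⟩ := exists_finset_restrict (Xn n) A
      rw [outerBoundary_restrict _ hR.le hB, mass_restrict _ _ hB,
        mass_restrict _ (m n) (bdry_subset _ _ _)]
      exact hexp n B hB

/-- Until a neighbourhood passes measure `1/2`, expansion applies to it, and widening by `R`
multiplies its measure by at least `1 + c`. -/
theorem Expands.lt_or_le_sum_nbhd {F : Finset X} {m : X → ℝ} (hm : ∀ x, 0 ≤ m x) {α c R : ℝ}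
    (hR : 0 ≤ R) (h : Expands F m α c R) (hc : 0 ≤ c) {A : Finset X} (hAF : A ⊆ F)
    (hA : α ≤ ∑ x ∈ A, m x) (k : ℕ) :
    1 / 2 < ∑ x ∈ nbhd F A (k * R), m x ∨ (1 + c) ^ k * α ≤ ∑ x ∈ nbhd F A (k * R), m x := by
  classical
  have hsub : ∀ k : ℕ, A ⊆ nbhd F A (k * R) := fun k x hx =>
    mem_nbhd.2 ⟨hAF hx, x, hx, by rw [dist_self]; positivity⟩
  have hmono : ∀ {B C : Finset X}, B ⊆ C → ∑ x ∈ B, m x ≤ ∑ x ∈ C, m x := fun hBC =>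
    Finset.sum_le_sum_of_subset_of_nonneg hBC fun x _ _ => hm x
  induction k with
  | zero => right; simpa using hA.trans (hmono (by simpa using hsub 0))
  | succ k ih =>
    set N := nbhd F A (k * R) with hN
    have hdisj : Disjoint N (bdry F N R) :=
      Finset.disjoint_right.2 fun x hx => (mem_bdry.1 hx).2.1
    have hstep : N ∪ bdry F N R ⊆ nbhd F A ((k + 1 : ℕ) * R) := by
      intro x hx
      rw [mem_nbhd]
      push_cast
      rcases Finset.mem_union.1 hx with hx | hx
      · obtain ⟨h1, a, ha, h2⟩ := mem_nbhd.1 hx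
        exact ⟨h1, a, ha, by linarith⟩
      · obtain ⟨h1, -, b, hb, h2⟩ := mem_bdry.1 hx
        obtain ⟨-, a, ha, h3⟩ := mem_nbhd.1 hb
        exact ⟨h1, a, ha, by linarith [dist_triangle x b a]⟩
    have hsum := hmono hstep
    rw [Finset.sum_union hdisj] at hsum
    have hb : 0 ≤ ∑ x ∈ bdry F N R, m x := Finset.sum_nonneg fun x _ => hm x
    by_cases hlt : 1 / 2 < ∑ x ∈ N, m x
    · left; linarith
    · right
      have h1 := ih.resolve_left hlt
      have h2 := h N (Finset.filter_subset _ _) (hA.trans (hmono (hsub k))) (not_lt.1 hlt)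
      rw [pow_succ]
      nlinarith

/-- In a measured asymptotic expander two sets of measure at least `α` are at bounded distance. -/
theorem Expands.exists_dist_le {F : Finset X} {m : X → ℝ} (hm : ∀ x, 0 ≤ m x)
    (hm1 : ∑ x ∈ F, m x = 1) {α c R : ℝ}
    (hR : 0 ≤ R) (h : Expands F m α c R) (hc : 0 ≤ c) {k : ℕ} (hk : 1 / 2 < (1 + c) ^ k * α)
    {A B : Finset X} (hAF : A ⊆ F) (hBF : B ⊆ F)
    (hA : α ≤ ∑ x ∈ A, m x) (hB : α ≤ ∑ x ∈ B, m x) :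
    ∃ a ∈ A, ∃ b ∈ B, dist a b ≤ 2 * (k * R) := by
  classical
  have key : ∀ A ⊆ F, α ≤ ∑ x ∈ A, m x → 1 / 2 < ∑ x ∈ nbhd F A (k * R), m x :=
    fun A hAF hA => (h.lt_or_le_sum_nbhd hm hR hc hAF hA k).elim id fun h => hk.trans_le h
  have h1 := key A hAF hA
  have h2 := key B hBF hB
  -- Two sets of measure above `1/2` in a space of total measure one must meet; a common point gives
  -- two legs of length `k * R`.
  have hnd : ¬ Disjoint (nbhd F A (k * R)) (nbhd F B (k * R)) := by
    intro hd
    have h3 : ∑ x ∈ nbhd F A (k * R) ∪ nbhd F B (k * R), m x ≤ ∑ x ∈ F, m x :=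
      Finset.sum_le_sum_of_subset_of_nonneg
        (Finset.union_subset (Finset.filter_subset _ _) (Finset.filter_subset _ _))
        fun x _ _ => hm x
    rw [Finset.sum_union hd] at h3
    linarith
  obtain ⟨x, hxA, hxB⟩ := Finset.not_disjoint_iff.1 hnd
  obtain ⟨-, a, ha, h3⟩ := mem_nbhd.1 hxA
  obtain ⟨-, b, hb, h4⟩ := mem_nbhd.1 hxB
  refine ⟨a, ha, b, hb, ?_⟩
  rw [dist_comm] at h3
  linarith [dist_triangle a x b]

end Expansion

/-! ### Quasi-locality of block-rank-one projections -/

section QuasiLocal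

variable {X H : Type*} [NormedAddCommGroup H] [InnerProductSpace ℂ H]
  {Xn : ℕ → Finset X} {P : Ell2 X H →L[ℂ] Ell2 X H} {ξ : ℕ → Ell2 X H}

open Classical in
-- Each block is the rank-one operator `η ↦ ⟪χ_B (ξ n), η⟫ • χ_A (ξ n)`, estimated by
-- Cauchy–Schwarz.
theorem IsAssociatedTo.norm_chi_comp_comp_chi_le (h : IsAssociatedTo Xn P ξ)
    (hd : Pairwise fun n m => Disjoint (Xn n) (Xn m)) (hc : ∀ x : X, ∃ n, x ∈ Xn n)
    {A B : Set X} {δ : ℝ} (hδ : 0 ≤ δ)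
    (hAB : ∀ n, (∑ x ∈ (Xn n).filter (· ∈ A), ‖ξ n x‖ ^ 2) *
      (∑ x ∈ (Xn n).filter (· ∈ B), ‖ξ n x‖ ^ 2) ≤ δ ^ 2) :
    ‖(chi A).comp (P.comp (chi B))‖ ≤ δ := by
  refine opNorm_le_of_blocks hd hc hδ fun n η => ?_
  have h1 : ∑ x ∈ Xn n, ‖(chi A).comp (P.comp (chi B)) η x‖ ^ 2 =
      ‖⟪ξ n, chi B η⟫_ℂ‖ ^ 2 * ∑ x ∈ (Xn n).filter (· ∈ A), ‖ξ n x‖ ^ 2 := by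
    rw [Finset.mul_sum, Finset.sum_filter]
    refine Finset.sum_congr rfl fun x hx => ?_
    change ‖chi A (P (chi B η)) x‖ ^ 2 = _
    split_ifs with hxA
    · rw [chi_apply_of_mem hxA, h.apply_of_mem hd hc _ hx, norm_smul, mul_pow]
    · rw [chi_apply_of_notMem hxA, norm_zero, zero_pow two_ne_zero]
  have h2 : ‖⟪ξ n, chi B η⟫_ℂ‖ ≤ ∑ x ∈ (Xn n).filter (· ∈ B), ‖ξ n x‖ * ‖η x‖ := by
    rw [inner_eq_sum (h.support n), Finset.sum_filter]
    refine (norm_sum_le _ _).trans (Finset.sum_le_sum fun x _ => ?_)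
    split_ifs with hxB
    · rw [chi_apply_of_mem hxB]; exact norm_inner_le_norm _ _
    · rw [chi_apply_of_notMem hxB, inner_zero_right, norm_zero]
  have h3 : ‖⟪ξ n, chi B η⟫_ℂ‖ ^ 2 ≤
      (∑ x ∈ (Xn n).filter (· ∈ B), ‖ξ n x‖ ^ 2) * ∑ x ∈ Xn n, ‖η x‖ ^ 2 := by
    refine (pow_le_pow_left₀ (norm_nonneg _) h2 2).trans
      ((Finset.sum_mul_sq_le_sq_mul_sq _ _ _).trans ?_)
    exact mul_le_mul_of_nonneg_left (Finset.sum_le_sum_of_subset_of_nonneg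
      (Finset.filter_subset _ _) fun _ _ _ => sq_nonneg _)
      (Finset.sum_nonneg fun _ _ => sq_nonneg _)
  rw [h1]
  have h4 : 0 ≤ ∑ x ∈ (Xn n).filter (· ∈ A), ‖ξ n x‖ ^ 2 :=
    Finset.sum_nonneg fun _ _ => sq_nonneg _
  have h5 : 0 ≤ ∑ x ∈ Xn n, ‖η x‖ ^ 2 := Finset.sum_nonneg fun _ _ => sq_nonneg _
  calc _ ≤ ((∑ x ∈ (Xn n).filter (· ∈ B), ‖ξ n x‖ ^ 2) * ∑ x ∈ Xn n, ‖η x‖ ^ 2) *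
        ∑ x ∈ (Xn n).filter (· ∈ A), ‖ξ n x‖ ^ 2 := mul_le_mul_of_nonneg_right h3 h4
    _ = ((∑ x ∈ (Xn n).filter (· ∈ A), ‖ξ n x‖ ^ 2) *
        ∑ x ∈ (Xn n).filter (· ∈ B), ‖ξ n x‖ ^ 2) * ∑ x ∈ Xn n, ‖η x‖ ^ 2 := by ring
    _ ≤ _ := mul_le_mul_of_nonneg_right (hAB n) h5

/-- Test on `χ_B (ξ n)`, where Cauchy–Schwarz is an equality. -/
theorem IsAssociatedTo.sum_mul_sum_le_norm_sq (h : IsAssociatedTo Xn P ξ) {n : ℕ}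
    {A B : Finset X} (hB : B ⊆ Xn n) :
    (∑ x ∈ A, ‖ξ n x‖ ^ 2) * (∑ x ∈ B, ‖ξ n x‖ ^ 2) ≤
      ‖(chi (A : Set X)).comp (P.comp (chi (B : Set X)))‖ ^ 2 := by
  set T := (chi (A : Set X)).comp (P.comp (chi (B : Set X))) with hT
  set a := ∑ x ∈ A, ‖ξ n x‖ ^ 2
  set b := ∑ x ∈ B, ‖ξ n x‖ ^ 2 with hb
  have hb0 : 0 ≤ b := Finset.sum_nonneg fun _ _ => sq_nonneg _
  have hsupp : ∀ x ∉ B, chi (B : Set X) (ξ n) x = 0 := fun x hx =>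
    chi_apply_of_notMem (by simpa using hx) _
  have h1 : ⟪ξ n, chi (B : Set X) (ξ n)⟫_ℂ = b := by
    rw [← inner_conj_symm, inner_eq_sum hsupp, hb, map_sum]
    push_cast
    refine Finset.sum_congr rfl fun x hx => ?_
    rw [inner_conj_symm, chi_apply_of_mem (by simpa using hx), inner_self_eq_norm_sq_to_K]
    rfl
  have h2 : T (chi (B : Set X) (ξ n)) = (b : ℂ) • chi (A : Set X) (ξ n) := by
    change chi (A : Set X) (P (chi (B : Set X) (chi (B : Set X) (ξ n)))) = _
    rw [chi_eq_self (f := chi (B : Set X) (ξ n)) (by simpa using hsupp),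
      h.apply_block n _ fun x hx => hsupp x fun hxB => hx (hB hxB), map_smul, h1]
  have h3 := T.le_opNorm (chi (B : Set X) (ξ n))
  rw [h2, norm_smul, Complex.norm_real, Real.norm_of_nonneg hb0] at h3
  have h4 := pow_le_pow_left₀ (by positivity) h3 2
  rw [mul_pow, mul_pow, sum_norm_sq_chi, sum_norm_sq_chi] at h4
  change b ^ 2 * a ≤ ‖T‖ ^ 2 * b at h4
  rcases hb0.eq_or_lt with h0 | h0
  · rw [← h0, mul_zero]; exact sq_nonneg _
  · refine le_of_mul_le_mul_right ?_ h0
    linarith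

theorem IsAssociatedTo.quasiLocal_iff [MetricSpace X] (h : IsAssociatedTo Xn P ξ)
    (hd : Pairwise fun n m => Disjoint (Xn n) (Xn m)) (hc : ∀ x : X, ∃ n, x ∈ Xn n) :
    QuasiLocal P ↔ MeasuredAsymptoticExpanders (fun n => Xn n) (fun n x => ‖ξ n x‖ ^ 2) := by
  classical
  have hm : ∀ n x, 0 ≤ ‖ξ n x‖ ^ 2 := fun _ _ => sq_nonneg _
  rw [measuredAsymptoticExpanders_iff hm h.sum_norm_sq]
  constructor
  · intro hQ α h0 _
    -- With this tolerance `m(A) m(B) < α / 4`, so `α ≤ m(A)` forces `m(B) < 1/4` for `B` far from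
    -- `A`. The boundary then has measure above `1 - 1/2 - 1/4 = 1/4`, more than `m(A) / 4`.
    obtain ⟨R, hR, hRAB⟩ := hQ (√α / 2) (by positivity)
    refine ⟨1 / 4, by norm_num, by norm_num, R + 1, by positivity, fun n A hA hA1 hA2 => ?_⟩
    set D := bdry (Xn n) A (R + 1) with hD
    have hDA : D ⊆ Xn n \ A := fun x hx => by
      obtain ⟨h1, h2, -⟩ := mem_bdry.1 hx
      exact Finset.mem_sdiff.2 ⟨h1, h2⟩
    set B := (Xn n \ A) \ D with hB
    have hBX : B ⊆ Xn n := Finset.sdiff_subset.trans Finset.sdiff_subset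
    have hlt := hRAB (A : Set X) (B : Set X) (lt_setEDist hR.le (lt_add_one R)
      fun a ha b hb => by
        by_contra hlt
        obtain ⟨h1, h2⟩ := Finset.mem_sdiff.1 (Finset.mem_coe.1 hb)
        obtain ⟨h3, h4⟩ := Finset.mem_sdiff.1 h1
        exact h2 (mem_bdry.2 ⟨h3, h4, a, ha, by rw [dist_comm]; exact (not_le.1 hlt).le⟩))
    have h1 := h.sum_mul_sum_le_norm_sq (A := A) hBX
    have h2 := pow_lt_pow_left₀ hlt (ContinuousLinearMap.opNorm_nonneg _) two_ne_zero
    rw [div_pow, Real.sq_sqrt h0.le] at h2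
    have h3 := Finset.sum_sdiff (f := fun x => ‖ξ n x‖ ^ 2) hA
    have h4 := Finset.sum_sdiff (f := fun x => ‖ξ n x‖ ^ 2) hDA
    rw [h.sum_norm_sq] at h3
    have hB0 : 0 ≤ ∑ x ∈ B, ‖ξ n x‖ ^ 2 := Finset.sum_nonneg fun x _ => hm n x
    have h5 : ∑ x ∈ B, ‖ξ n x‖ ^ 2 < 1 / 4 := by
      by_contra hge
      have := mul_le_mul hA1 (not_lt.1 hge) (by norm_num) (h0.le.trans hA1)
      linarith
    linarith
  · intro hE ε hε
    set α := min (1 / 2) ((ε / 2) ^ 2) with hα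
    have hα0 : 0 < α := lt_min (by norm_num) (by positivity)
    obtain ⟨c, hc0, -, R, hR, hexp⟩ := hE α hα0 (min_le_left _ _)
    obtain ⟨k, hk⟩ := pow_unbounded_of_one_lt (1 / 2 / α) (by linarith : 1 < 1 + c)
    rw [div_lt_iff₀ hα0] at hk
    refine ⟨2 * (k * R) + 1, by positivity, fun A B hAB => ?_⟩
    refine (h.norm_chi_comp_comp_chi_le hd hc (half_pos hε).le fun n => ?_).trans_lt
      (half_lt_self hε)
    set a := ∑ x ∈ (Xn n).filter (· ∈ A), ‖ξ n x‖ ^ 2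
    set b := ∑ x ∈ (Xn n).filter (· ∈ B), ‖ξ n x‖ ^ 2
    have ha0 : 0 ≤ a := Finset.sum_nonneg fun x _ => hm n x
    have hb0 : 0 ≤ b := Finset.sum_nonneg fun x _ => hm n x
    have hle1 : ∀ S ⊆ Xn n, ∑ x ∈ S, ‖ξ n x‖ ^ 2 ≤ 1 := fun S hS => by
      rw [← h.sum_norm_sq n]
      exact Finset.sum_le_sum_of_subset_of_nonneg hS fun x _ _ => hm n x
    have ha1 : a ≤ 1 := hle1 _ (Finset.filter_subset _ _)
    have hb1 : b ≤ 1 := hle1 _ (Finset.filter_subset _ _)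
    refine le_trans ?_ (min_le_right (1 / 2) ((ε / 2) ^ 2))
    rw [← hα]
    by_contra hlt
    rw [not_le] at hlt
    -- As `a, b ≤ 1`, a product above `α` forces each factor above `α`.
    have ha : α ≤ a := by nlinarith
    have hb : α ≤ b := by nlinarith
    obtain ⟨x, hx, y, hy, hxy⟩ := (hexp n).exists_dist_le (hm n) (h.sum_norm_sq n) hR.le hc0.le hk
      (Finset.filter_subset _ _) (Finset.filter_subset _ _) ha hb
    have := lt_dist_of_lt_setEDist hAB (Finset.mem_filter.1 hx).2 (Finset.mem_filter.1 hy).2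
    linarith

end QuasiLocal

/-! ### Cheeger's inequality for finite weighted graphs -/

section Cheeger

variable {X : Type*}

/-- The total weight of the edges from `A` to `B`. -/
def flow (w : X → X → ℝ) (A B : Finset X) : ℝ := ∑ x ∈ A, ∑ y ∈ B, w x y

theorem flow_comm {w : X → X → ℝ} (hs : ∀ x y, w x y = w y x) (A B : Finset X) :
    flow w A B = flow w B A := by
  rw [flow, Finset.sum_comm]
  exact Finset.sum_congr rfl fun _ _ => Finset.sum_congr rfl fun _ _ => hs _ _

theorem flow_mono_right {w : X → X → ℝ} (hw : ∀ x y, 0 ≤ w x y) (A : Finset X) {B B' : Finset X}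
    (h : B ⊆ B') : flow w A B ≤ flow w A B' :=
  Finset.sum_le_sum fun _ _ => Finset.sum_le_sum_of_subset_of_nonneg h fun _ _ _ => hw _ _

/-- The Dirichlet form of `f` on `Y` with respect to the weights `w`; every edge is counted in
both directions. -/
def dirichlet (w : X → X → ℝ) (Y : Finset X) (f : X → ℝ) : ℝ :=
  ∑ x ∈ Y, ∑ y ∈ Y, w x y * (f x - f y) ^ 2

variable {w : X → X → ℝ} {m : X → ℝ} {Y : Finset X} {c D : ℝ}

theorem sum_sum_mul_left_le (hD : ∀ x ∈ Y, ∑ y ∈ Y, w x y ≤ D * m x) {h : X → ℝ}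
    (hh : ∀ x, 0 ≤ h x) : ∑ x ∈ Y, ∑ y ∈ Y, w x y * h x ≤ D * ∑ x ∈ Y, h x * m x := by
  rw [Finset.mul_sum]
  refine Finset.sum_le_sum fun x hx => ?_
  rw [← Finset.sum_mul]
  calc _ ≤ D * m x * h x := mul_le_mul_of_nonneg_right (hD x hx) (hh x)
    _ = _ := by ring

theorem sum_sum_mul_right_le (hs : ∀ x y, w x y = w y x)
    (hD : ∀ x ∈ Y, ∑ y ∈ Y, w x y ≤ D * m x) {h : X → ℝ}
    (hh : ∀ x, 0 ≤ h x) : ∑ x ∈ Y, ∑ y ∈ Y, w x y * h y ≤ D * ∑ x ∈ Y, h x * m x := by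
  rw [Finset.sum_comm]
  simp only [fun x y => hs y x]
  exact sum_sum_mul_left_le hD hh

/-- From `(a - b)² ≤ 2 a² + 2 b²`. It will keep the quadratic form of the lazy walk minus its limit
nonnegative, leaving only an upper bound to prove. -/
theorem dirichlet_le (hw : ∀ x y, 0 ≤ w x y) (hs : ∀ x y, w x y = w y x)
    (hD : ∀ x ∈ Y, ∑ y ∈ Y, w x y ≤ D * m x) (f : X → ℝ) :
    dirichlet w Y f ≤ 4 * D * ∑ x ∈ Y, f x ^ 2 * m x := by
  have h1 : dirichlet w Y f ≤
      ∑ x ∈ Y, ∑ y ∈ Y, (2 * (w x y * f x ^ 2) + 2 * (w x y * f y ^ 2)) := by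
    refine Finset.sum_le_sum fun x _ => Finset.sum_le_sum fun y _ => ?_
    nlinarith [mul_nonneg (hw x y) (sq_nonneg (f x + f y))]
  simp only [Finset.sum_add_distrib, ← Finset.mul_sum] at h1
  have h2 := sum_sum_mul_left_le hD (h := fun x => f x ^ 2) fun x => sq_nonneg _
  have h3 := sum_sum_mul_right_le hs hD (h := fun x => f x ^ 2) fun x => sq_nonneg _
  linarith

/-- Take the least value `f z` whose strict superlevel set has at most half the mass. If `f y` is
the next smaller value, then `{f > f y} = {f ≥ f z}` has more than half, leaving less than half
below `f z`. -/
theorem exists_median (m f : X → ℝ) (hY : Y.Nonempty) (hm : ∀ x, 0 ≤ m x) :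
    ∃ s : ℝ, 2 * ∑ x ∈ Y with s < f x, m x ≤ ∑ x ∈ Y, m x ∧
      2 * ∑ x ∈ Y with f x < s, m x ≤ ∑ x ∈ Y, m x := by
  let S := Y.filter fun z => 2 * ∑ x ∈ Y with f z < f x, m x ≤ ∑ x ∈ Y, m x
  have hS : S.Nonempty := by
    obtain ⟨z, hz, hmax⟩ := Y.exists_max_image f hY
    refine ⟨z, Finset.mem_filter.2 ⟨hz, ?_⟩⟩
    rw [Finset.filter_false_of_mem fun x hx => not_lt.2 (hmax x hx), Finset.sum_empty, mul_zero]
    exact Finset.sum_nonneg fun x _ => hm x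
  obtain ⟨z, hz, hmin⟩ := S.exists_min_image f hS
  refine ⟨f z, (Finset.mem_filter.1 hz).2, ?_⟩
  rcases (Y.filter fun x => f x < f z).eq_empty_or_nonempty with h0 | hne
  · rw [h0, Finset.sum_empty, mul_zero]
    exact Finset.sum_nonneg fun x _ => hm x
  · obtain ⟨y, hy, hmax⟩ := Finset.exists_max_image _ f hne
    obtain ⟨hyY, hyz⟩ := Finset.mem_filter.1 hy
    have h1 : y ∉ S := fun h => absurd (hmin y h) (not_le.2 hyz)
    have h2 : ∑ x ∈ Y, m x < 2 * ∑ x ∈ Y with f y < f x, m x := by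
      by_contra h
      exact h1 (Finset.mem_filter.2 ⟨hyY, not_lt.1 h⟩)
    have h3 := Finset.sum_filter_add_sum_filter_not Y (fun x => f x < f z) m
    have h4 : ∑ x ∈ Y with f y < f x, m x ≤ ∑ x ∈ Y with ¬ f x < f z, m x := by
      refine Finset.sum_le_sum_of_subset_of_nonneg (fun x hx => ?_) fun x _ _ => hm x
      obtain ⟨hx1, hx2⟩ := Finset.mem_filter.1 hx
      exact Finset.mem_filter.2 ⟨hx1, fun h =>
        absurd (hmax x (Finset.mem_filter.2 ⟨hx1, h⟩)) (not_le.2 hx2)⟩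
    linarith

variable [DecidableEq X]

theorem sum_sum_mul_abs_indicator (hs : ∀ x y, w x y = w y x) {A : Finset X} (hA : A ⊆ Y) :
    ∑ x ∈ Y, ∑ y ∈ Y, w x y * |(if x ∈ A then (1 : ℝ) else 0) - if y ∈ A then 1 else 0| =
      2 * flow w A (Y \ A) := by
  have h1 : ∀ x y, w x y * |(if x ∈ A then (1 : ℝ) else 0) - if y ∈ A then 1 else 0| =
      (if x ∈ A then if y ∉ A then w x y else 0 else 0) +
        if x ∉ A then if y ∈ A then w x y else 0 else 0 := by
    intro x y
    by_cases hx : x ∈ A <;> by_cases hy : y ∈ A <;> simp [hx, hy]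
  have h2 : ∀ B C : Finset X, B ⊆ Y → C ⊆ Y →
      ∑ x ∈ Y, ∑ y ∈ Y, (if x ∈ B then if y ∈ C then w x y else 0 else 0) = flow w B C := by
    intro B C hB hC
    have hB' : (Y.filter fun x => x ∈ B) = B := by
      rw [Finset.filter_mem_eq_inter, Finset.inter_eq_right.2 hB]
    have hC' : (Y.filter fun x => x ∈ C) = C := by
      rw [Finset.filter_mem_eq_inter, Finset.inter_eq_right.2 hC]
    calc _ = ∑ x ∈ Y, if x ∈ B then ∑ y ∈ C, w x y else 0 := by
          refine Finset.sum_congr rfl fun x _ => ?_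
          split_ifs
          · rw [← Finset.sum_filter, hC']
          · exact Finset.sum_const_zero
      _ = flow w B C := by rw [← Finset.sum_filter, hB', flow]
  have h3 : ∀ x ∈ Y, ∀ y ∈ Y,
      w x y * |(if x ∈ A then (1 : ℝ) else 0) - if y ∈ A then 1 else 0| =
      (if x ∈ A then if y ∈ Y \ A then w x y else 0 else 0) +
        if x ∈ Y \ A then if y ∈ A then w x y else 0 else 0 := by
    intro x hx y hy
    rw [h1]
    simp only [Finset.mem_sdiff, hx, hy, true_and]
  rw [Finset.sum_congr rfl fun x hx => Finset.sum_congr rfl fun y hy => h3 x hx y hy]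
  simp only [Finset.sum_add_distrib]
  rw [h2 A _ hA Finset.sdiff_subset, h2 _ A Finset.sdiff_subset hA, flow_comm hs (Y \ A) A]
  ring

/-- The co-area inequality. -/
theorem coarea_le (hw : ∀ x y, 0 ≤ w x y) (hs : ∀ x y, w x y = w y x)
    (hm : ∀ x, 0 ≤ m x)
    (hc : ∀ A ⊆ Y, 2 * ∑ x ∈ A, m x ≤ ∑ x ∈ Y, m x → c * ∑ x ∈ A, m x ≤ flow w A (Y \ A))
    {g : X → ℝ} (hg : ∀ x, 0 ≤ g x)
    (hsupp : 2 * ∑ x ∈ Y with g x ≠ 0, m x ≤ ∑ x ∈ Y, m x) :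
    2 * (c * ∑ x ∈ Y, g x * m x) ≤ ∑ x ∈ Y, ∑ y ∈ Y, w x y * |g x - g y| := by
  induction hn : (Y.filter fun x => g x ≠ 0).card using Nat.strong_induction_on generalizing g with
  | _ n ih =>
    set A := Y.filter fun x => g x ≠ 0 with hA
    have hAY : A ⊆ Y := Finset.filter_subset _ _
    rcases A.eq_empty_or_nonempty with h0 | hne
    · have h1 : ∀ x ∈ Y, g x = 0 := fun x hx => by
        by_contra hx0
        exact Finset.notMem_empty x (h0 ▸ Finset.mem_filter.2 ⟨hx, hx0⟩)
      rw [Finset.sum_eq_zero fun x hx => by rw [h1 x hx, zero_mul], mul_zero, mul_zero]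
      exact Finset.sum_nonneg fun _ _ => Finset.sum_nonneg fun _ _ =>
        mul_nonneg (hw _ _) (abs_nonneg _)
    -- Peel off the bottom layer: write `g = g' + t • 1_A` with `t` the least nonzero value of `g`.
    -- The layer contributes the flow out of `A`, and `g'` has smaller support because it vanishes
    -- at `z`.
    · obtain ⟨z, hz, hmin⟩ := A.exists_min_image g hne
      set t := g z with ht
      have ht0 : 0 < t := (hg z).lt_of_ne' (Finset.mem_filter.1 hz).2
      let i : X → ℝ := fun x => if x ∈ A then 1 else 0
      let g' : X → ℝ := fun x => if x ∈ A then g x - t else 0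
      have hg' : ∀ x, 0 ≤ g' x := fun x => by
        simp only [g']
        split_ifs with hx
        · exact sub_nonneg.2 (hmin x hx)
        · exact le_rfl
      have hsub : (Y.filter fun x => g' x ≠ 0) ⊆ A.erase z := by
        intro x hx
        have hx2 := (Finset.mem_filter.1 hx).2
        have hxA : x ∈ A := by
          by_contra hxA
          exact hx2 (if_neg hxA)
        refine Finset.mem_erase.2 ⟨fun hxz => hx2 ?_, hxA⟩
        simp only [g', if_pos hxA]
        rw [hxz, ← ht, sub_self]
      have hcard : (Y.filter fun x => g' x ≠ 0).card < n :=
        (Finset.card_le_card hsub).trans_lt (hn ▸ Finset.card_erase_lt_of_mem hz)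
      have hmle : ∑ x ∈ Y with g' x ≠ 0, m x ≤ ∑ x ∈ A, m x :=
        Finset.sum_le_sum_of_subset_of_nonneg (hsub.trans (Finset.erase_subset _ _))
          fun x _ _ => hm x
      have h1 := ih _ hcard hg' (by linarith) rfl
      have h2 := hc A hAY hsupp
      have hgi : ∀ x ∈ Y, g x = g' x + t * i x := by
        intro x hx
        by_cases hxA : x ∈ A
        · simp [g', i, hxA]
        · have : g x = 0 := by
            by_contra h
            exact hxA (Finset.mem_filter.2 ⟨hx, h⟩)
          simp [g', i, hxA, this]
      have h3 : ∑ x ∈ Y, g x * m x = ∑ x ∈ Y, g' x * m x + t * ∑ x ∈ A, m x := by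
        have : ∑ x ∈ A, m x = ∑ x ∈ Y, i x * m x := by
          simp only [i, ite_mul, one_mul, zero_mul]
          rw [← Finset.sum_filter, Finset.filter_mem_eq_inter, Finset.inter_eq_right.2 hAY]
        rw [this, Finset.mul_sum, ← Finset.sum_add_distrib]
        exact Finset.sum_congr rfl fun x hx => by rw [hgi x hx]; ring
      have h4 : ∑ x ∈ Y, ∑ y ∈ Y, w x y * |g x - g y| =
          ∑ x ∈ Y, ∑ y ∈ Y, w x y * |g' x - g' y| + t * (2 * flow w A (Y \ A)) := by
        rw [← sum_sum_mul_abs_indicator hs hAY, Finset.mul_sum, ← Finset.sum_add_distrib]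
        refine Finset.sum_congr rfl fun x hx => ?_
        rw [Finset.mul_sum, ← Finset.sum_add_distrib]
        refine Finset.sum_congr rfl fun y hy => ?_
        rw [hgi x hx, hgi y hy]
        -- No cancellation occurs: `g' ≥ 0` vanishes off `A`, so across the boundary of `A` both
        -- differences have the same sign.
        have : |g' x + t * i x - (g' y + t * i y)| = |g' x - g' y| + t * |i x - i y| := by
          by_cases hxA : x ∈ A <;> by_cases hyA : y ∈ A
          · simp [i, hxA, hyA]
          · have := hg' x
            have hy0 : g' y = 0 := if_neg hyA
            simp only [i, hxA, hyA, if_true, if_false, hy0]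
            rw [abs_of_nonneg (by linarith), abs_of_nonneg (by linarith)]
            simp
          · have := hg' y
            have hx0 : g' x = 0 := if_neg hxA
            simp only [i, hxA, hyA, if_true, if_false, hx0]
            rw [abs_of_nonpos (by linarith), abs_of_nonpos (by linarith)]
            simp
          · simp [i, hxA, hyA]
        rw [this]
        ring
      rw [h3, h4]
      nlinarith

/-- Apply the co-area inequality to `g ^ 2`, factor the difference of squares and use a weighted
AM–GM inequality. -/
theorem sq_mul_sum_le_dirichlet (hw : ∀ x y, 0 ≤ w x y) (hs : ∀ x y, w x y = w y x)
    (hm : ∀ x, 0 ≤ m x) (hD0 : 0 < D) (hD : ∀ x ∈ Y, ∑ y ∈ Y, w x y ≤ D * m x) (hc0 : 0 < c)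
    (hc : ∀ A ⊆ Y, 2 * ∑ x ∈ A, m x ≤ ∑ x ∈ Y, m x → c * ∑ x ∈ A, m x ≤ flow w A (Y \ A))
    {g : X → ℝ} (hg : ∀ x, 0 ≤ g x)
    (hsupp : 2 * ∑ x ∈ Y with g x ≠ 0, m x ≤ ∑ x ∈ Y, m x) :
    c ^ 2 * ∑ x ∈ Y, g x ^ 2 * m x ≤ D * dirichlet w Y g := by
  have h1 := coarea_le hw hs hm hc (g := fun x => g x ^ 2) (fun x => sq_nonneg _) (by
    simpa using hsupp)
  set G := ∑ x ∈ Y, g x ^ 2 * m x with hG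
  have h2 : ∑ x ∈ Y, ∑ y ∈ Y, w x y * |g x ^ 2 - g y ^ 2| ≤
      ∑ x ∈ Y, ∑ y ∈ Y, (D / c * (w x y * (g x - g y) ^ 2) +
        (c / (2 * D) * (w x y * g x ^ 2) + c / (2 * D) * (w x y * g y ^ 2))) := by
    refine Finset.sum_le_sum fun x _ => Finset.sum_le_sum fun y _ => ?_
    have h3 : |g x ^ 2 - g y ^ 2| = |g x - g y| * (g x + g y) := by
      rw [sq_sub_sq, abs_mul, abs_of_nonneg (add_nonneg (hg x) (hg y)), mul_comm]
    have h4 : |g x - g y| * (g x + g y) ≤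
        D / c * (g x - g y) ^ 2 + c / (4 * D) * (g x + g y) ^ 2 := by
      -- The weights are tuned so that the terms in `g x ^ 2` and `g y ^ 2` add up to `c * G`,
      -- exactly half of the left side of `h1`.
      have h5 : 0 ≤ (2 * D * |g x - g y| - c * (g x + g y)) ^ 2 / (4 * c * D) := by positivity
      have h6 : (2 * D * |g x - g y| - c * (g x + g y)) ^ 2 / (4 * c * D) =
          D / c * |g x - g y| ^ 2 + c / (4 * D) * (g x + g y) ^ 2 -
            |g x - g y| * (g x + g y) := by
        field_simp
        ring
      rw [sq_abs] at h6
      linarith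
    have h7 : c / (4 * D) * (g x + g y) ^ 2 ≤ c / (2 * D) * (g x ^ 2 + g y ^ 2) := by
      have h8 : c / (2 * D) = 2 * (c / (4 * D)) := by field_simp; norm_num
      have h9 : 0 < c / (4 * D) := by positivity
      rw [h8]
      nlinarith [mul_nonneg h9.le (sq_nonneg (g x - g y))]
    rw [h3]
    calc w x y * (|g x - g y| * (g x + g y)) ≤
          w x y * (D / c * (g x - g y) ^ 2 + c / (2 * D) * (g x ^ 2 + g y ^ 2)) :=
          mul_le_mul_of_nonneg_left (by linarith) (hw x y)
      _ = _ := by ring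
  have h3 := sum_sum_mul_left_le hD (h := fun x => g x ^ 2) fun x => sq_nonneg _
  have h4 := sum_sum_mul_right_le hs hD (h := fun x => g x ^ 2) fun x => sq_nonneg _
  simp only [Finset.sum_add_distrib, ← Finset.mul_sum] at h2 h3 h4
  rw [← hG] at h3 h4
  have h5 : 2 * (c * G) ≤ D / c * dirichlet w Y g + c / (2 * D) * (D * G) +
      c / (2 * D) * (D * G) := by
    have h6 : 0 ≤ c / (2 * D) := by positivity
    have h7 := mul_le_mul_of_nonneg_left h3 h6
    have h8 := mul_le_mul_of_nonneg_left h4 h6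
    simp only [dirichlet]
    linarith
  have h6 : c / (2 * D) * (D * G) + c / (2 * D) * (D * G) = c * G := by field_simp; ring
  have h7 : c * G ≤ D / c * dirichlet w Y g := by linarith
  have h8 := mul_le_mul_of_nonneg_left h7 hc0.le
  have h9 : c * (D / c * dirichlet w Y g) = D * dirichlet w Y g := by field_simp
  linarith

/-- **Cheeger's inequality**, as a Poincaré inequality. -/
theorem poincare (hw : ∀ x y, 0 ≤ w x y) (hs : ∀ x y, w x y = w y x)
    (hm : ∀ x, 0 ≤ m x) (hD0 : 0 < D) (hD : ∀ x ∈ Y, ∑ y ∈ Y, w x y ≤ D * m x) (hc0 : 0 < c)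
    (hc : ∀ A ⊆ Y, 2 * ∑ x ∈ A, m x ≤ ∑ x ∈ Y, m x → c * ∑ x ∈ A, m x ≤ flow w A (Y \ A))
    {f : X → ℝ} (hf : ∑ x ∈ Y, f x * m x = 0) :
    c ^ 2 * ∑ x ∈ Y, f x ^ 2 * m x ≤ D * dirichlet w Y f := by
  rcases Y.eq_empty_or_nonempty with rfl | hY
  · simp [dirichlet]
  obtain ⟨s, hs1, hs2⟩ := exists_median m f hY hm
  -- Cut at the median: each of the two parts of `f - s` lives on at most half the mass, and
  -- truncation does not increase the Dirichlet form.
  let p : X → ℝ := fun x => max (f x - s) 0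
  let q : X → ℝ := fun x => max (s - f x) 0
  have hp := sq_mul_sum_le_dirichlet hw hs hm hD0 hD hc0 hc (g := p) (fun x => le_max_right _ _) (by
    refine le_trans (mul_le_mul_of_nonneg_left (Finset.sum_le_sum_of_subset_of_nonneg
      (fun x hx => ?_) fun x _ _ => hm x) zero_le_two) hs1
    obtain ⟨h1, h2⟩ := Finset.mem_filter.1 hx
    refine Finset.mem_filter.2 ⟨h1, ?_⟩
    by_contra h
    exact h2 (max_eq_right (by linarith)))
  have hq := sq_mul_sum_le_dirichlet hw hs hm hD0 hD hc0 hc (g := q) (fun x => le_max_right _ _) (by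
    refine le_trans (mul_le_mul_of_nonneg_left (Finset.sum_le_sum_of_subset_of_nonneg
      (fun x hx => ?_) fun x _ _ => hm x) zero_le_two) hs2
    obtain ⟨h1, h2⟩ := Finset.mem_filter.1 hx
    refine Finset.mem_filter.2 ⟨h1, ?_⟩
    by_contra h
    exact h2 (max_eq_right (by linarith)))
  have h1 : dirichlet w Y p + dirichlet w Y q ≤ dirichlet w Y f := by
    simp only [dirichlet, ← Finset.sum_add_distrib]
    refine Finset.sum_le_sum fun x _ => Finset.sum_le_sum fun y _ => ?_
    rw [← mul_add]
    refine mul_le_mul_of_nonneg_left ?_ (hw x y)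
    simp only [p, q]
    rcases le_total (f x) s with h | h <;> rcases le_total (f y) s with h' | h'
    · rw [max_eq_right (by linarith), max_eq_right (by linarith), max_eq_left (by linarith),
        max_eq_left (by linarith)]
      apply le_of_eq; ring
    · rw [max_eq_right (by linarith), max_eq_left (by linarith), max_eq_left (by linarith),
        max_eq_right (by linarith)]
      nlinarith [mul_nonneg (sub_nonneg.2 h) (sub_nonneg.2 h')]
    · rw [max_eq_left (by linarith), max_eq_right (by linarith), max_eq_right (by linarith),
        max_eq_left (by linarith)]
      nlinarith [mul_nonneg (sub_nonneg.2 h) (sub_nonneg.2 h')]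
    · rw [max_eq_left (by linarith), max_eq_left (by linarith), max_eq_right (by linarith),
        max_eq_right (by linarith)]
      apply le_of_eq; ring
  -- A function of mean zero has its least second moment about `0`.
  have h2 : ∑ x ∈ Y, f x ^ 2 * m x ≤ ∑ x ∈ Y, p x ^ 2 * m x + ∑ x ∈ Y, q x ^ 2 * m x := by
    have h3 : ∑ x ∈ Y, p x ^ 2 * m x + ∑ x ∈ Y, q x ^ 2 * m x =
        ∑ x ∈ Y, (f x ^ 2 * m x - 2 * s * (f x * m x) + s ^ 2 * m x) := by
      rw [← Finset.sum_add_distrib]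
      refine Finset.sum_congr rfl fun x _ => ?_
      simp only [p, q]
      rcases le_total (f x) s with h | h
      · rw [max_eq_right (by linarith), max_eq_left (by linarith)]; ring
      · rw [max_eq_left (by linarith), max_eq_right (by linarith)]; ring
    rw [h3, Finset.sum_add_distrib, Finset.sum_sub_distrib, ← Finset.mul_sum, hf]
    have : 0 ≤ ∑ x ∈ Y, s ^ 2 * m x :=
      Finset.sum_nonneg fun x _ => mul_nonneg (sq_nonneg _) (hm x)
    linarith
  have h3 := mul_le_mul_of_nonneg_left h2 (sq_nonneg c)
  have h4 := mul_le_mul_of_nonneg_left h1 hD0.le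
  linarith

/-- A measure whose medium-sized sets have large boundary flow becomes expanding after removing a
set of small measure. -/
theorem exists_expanding_subset {F : Finset X} {κ a : ℝ} (hw : ∀ x y, 0 ≤ w x y)
    (hs : ∀ x y, w x y = w y x) (hm : ∀ x, 0 ≤ m x) (hm1 : ∑ x ∈ F, m x = 1)
    (hκ : 0 < κ) (ha : a ≤ 1 / 4)
    (hflow : ∀ A ⊆ F, a ≤ ∑ x ∈ A, m x → ∑ x ∈ A, m x ≤ 1 / 2 → κ ≤ flow w A (F \ A)) :
    ∃ Y ⊆ F, 1 - a ≤ ∑ x ∈ Y, m x ∧ ∀ A ⊆ Y, A.Nonempty → 2 * ∑ x ∈ A, m x ≤ ∑ x ∈ Y, m x →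
      κ / 2 * ∑ x ∈ A, m x < flow w A (Y \ A) := by
  -- Remove a largest bad set: measure at most `1/2` and flow below the desired bound. By `hflow`
  -- its measure is in fact below `a`.
  let 𝒵 := F.powerset.filter fun Z =>
    2 * ∑ x ∈ Z, m x ≤ 1 ∧ flow w Z (F \ Z) ≤ κ / 2 * ∑ x ∈ Z, m x
  have h𝒵 : 𝒵.Nonempty := ⟨∅, Finset.mem_filter.2
    ⟨Finset.mem_powerset.2 (Finset.empty_subset _), by simp, by simp [flow]⟩⟩
  obtain ⟨Z, hZ, hmax⟩ := 𝒵.exists_max_image Finset.card h𝒵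
  obtain ⟨hZF, hZ1, hZ2⟩ := Finset.mem_filter.1 hZ
  rw [Finset.mem_powerset] at hZF
  have hsum0 : ∀ S : Finset X, 0 ≤ ∑ x ∈ S, m x := fun S => Finset.sum_nonneg fun x _ => hm x
  have hZa : ∑ x ∈ Z, m x < a := by
    by_contra h
    have := hflow Z hZF (not_lt.1 h) (by linarith)
    nlinarith
  have hY := Finset.sum_sdiff (f := m) hZF
  rw [hm1] at hY
  refine ⟨F \ Z, Finset.sdiff_subset, by linarith, fun A hA hne hA2 => ?_⟩
  by_contra hcon
  rw [not_lt] at hcon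
  have hAF : A ⊆ F := hA.trans Finset.sdiff_subset
  have hdisj : Disjoint A Z :=
    Finset.disjoint_left.2 fun x hx hxZ => (Finset.mem_sdiff.1 (hA hx)).2 hxZ
  have hU : A ∪ Z ⊆ F := Finset.union_subset hAF hZF
  have hUsum := Finset.sum_union (f := m) hdisj
  have hUflow : flow w (A ∪ Z) (F \ (A ∪ Z)) ≤ κ / 2 * ∑ x ∈ A ∪ Z, m x := by
    have h1 : flow w (A ∪ Z) (F \ (A ∪ Z)) =
        flow w A (F \ (A ∪ Z)) + flow w Z (F \ (A ∪ Z)) := Finset.sum_union hdisj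
    have h2 : flow w A (F \ (A ∪ Z)) ≤ flow w A ((F \ Z) \ A) := flow_mono_right hw A fun x hx => by
      simp only [Finset.mem_sdiff, Finset.mem_union, not_or] at hx ⊢
      tauto
    have h3 : flow w Z (F \ (A ∪ Z)) ≤ flow w Z (F \ Z) :=
      flow_mono_right hw Z (Finset.sdiff_subset_sdiff subset_rfl Finset.subset_union_right)
    rw [h1, hUsum]
    linarith
  -- A bad `A` makes `A ∪ Z` violate the flow bound too, so maximality of `Z` leaves only excess
  -- measure. The complement of `A ∪ Z` is then of medium size, its measure exceeding `(1 - a) / 2 ≥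
  -- a`, and `hflow` applied to it gives the contradiction.
  have hbig : 1 < 2 * ∑ x ∈ A ∪ Z, m x := by
    by_contra h
    have h1 := hmax (A ∪ Z) (Finset.mem_filter.2
      ⟨Finset.mem_powerset.2 hU, not_lt.1 h, hUflow⟩)
    rw [Finset.card_union_of_disjoint hdisj] at h1
    have := hne.card_pos
    omega
  have hC := Finset.sum_sdiff (f := m) hU
  rw [hm1] at hC
  have h1 := hflow (F \ (A ∪ Z)) Finset.sdiff_subset (by linarith) (by linarith)
  rw [Finset.sdiff_sdiff_eq_self hU, flow_comm hs] at h1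
  have h2 := hsum0 (F \ (A ∪ Z))
  nlinarith

end Cheeger

/-! ### Edge weights of measured asymptotic expanders -/

section Weights

variable {X : Type*} [MetricSpace X]

open Classical in
/-- The weight `min (m x) (m y)` on the pairs of points at distance at most `R`. -/
noncomputable def minWeight (m : X → ℝ) (R : ℝ) (x y : X) : ℝ :=
  if dist x y ≤ R then min (m x) (m y) else 0

variable {m : X → ℝ} {R : ℝ}

theorem minWeight_nonneg (hm : ∀ x, 0 ≤ m x) (x y : X) : 0 ≤ minWeight m R x y := by
  rw [minWeight]
  split_ifs
  · exact le_min (hm x) (hm y)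
  · exact le_rfl

theorem minWeight_comm (x y : X) : minWeight m R x y = minWeight m R y x := by
  rw [minWeight, minWeight, dist_comm, min_comm]

theorem minWeight_le_left (hm : ∀ x, 0 ≤ m x) (x y : X) : minWeight m R x y ≤ m x := by
  rw [minWeight]
  split_ifs
  · exact min_le_left _ _
  · exact hm x

open Classical in
theorem sum_minWeight_le (hm : ∀ x, 0 ≤ m x) {N : ℝ} (Y : Finset X)
    (x : X) (hN : ((Y.filter fun y => dist x y ≤ R).card : ℝ) ≤ N) :
    ∑ y ∈ Y, minWeight m R x y ≤ N * m x := by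
  simp only [minWeight]
  rw [← Finset.sum_filter]
  refine (Finset.sum_le_card_nsmul _ _ (m x) fun y _ => min_le_left _ _).trans ?_
  rw [nsmul_eq_mul]
  exact mul_le_mul_of_nonneg_right hN (hm x)

open Classical in
/-- In a space of bounded geometry, most boundary points of a medium-sized set have a neighbour of
comparable mass in the set. -/
theorem Expands.le_flow {F : Finset X} (hm : ∀ x, 0 ≤ m x) (hm1 : ∑ x ∈ F, m x = 1)
    {N a c s : ℝ} (hN : ∀ x ∈ F, ((F.filter fun y => dist x y ≤ R).card : ℝ) ≤ N)
    (ha : 0 < a) (hc0 : 0 < c) (hc1 : c < 1) (hs : 1 ≤ s) (hNs : N / s ≤ c * a / 8)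
    (hexp : Expands F m (a / 2) c R) {A : Finset X} (hAF : A ⊆ F)
    (hA1 : a ≤ ∑ x ∈ A, m x) (hA2 : ∑ x ∈ A, m x ≤ 1 / 2) :
    c * a / (4 * s) ≤ flow (minWeight m R) A (F \ A) := by
  have hs0 : 0 < s := one_pos.trans_le hs
  -- `L` consists of the points with a neighbour more than `s` times heavier. Charging each to such
  -- a neighbour, which has at most `N` neighbours, gives `L` measure at most `N / s`.
  let L := F.filter fun x => ∃ y ∈ F, dist x y ≤ R ∧ s * m x < m y
  have hL : ∑ x ∈ L, m x ≤ N / s := by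
    calc ∑ x ∈ L, m x ≤ ∑ x ∈ L, ∑ y ∈ F, (if dist y x ≤ R then m y / s else 0) := by
          refine Finset.sum_le_sum fun x hx => ?_
          obtain ⟨-, y, hy, hd, hlt⟩ := Finset.mem_filter.1 hx
          have h1 := Finset.single_le_sum (f := fun y => if dist y x ≤ R then m y / s else 0)
            (fun z _ => by
              split_ifs
              · exact div_nonneg (hm z) hs0.le
              · exact le_rfl) hy
          refine le_trans ?_ h1
          rw [if_pos (by rwa [dist_comm]), le_div_iff₀ hs0]
          linarith
      _ ≤ ∑ x ∈ F, ∑ y ∈ F, (if dist y x ≤ R then m y / s else 0) := by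
          refine Finset.sum_le_sum_of_subset_of_nonneg (Finset.filter_subset _ _) fun x _ _ =>
            Finset.sum_nonneg fun z _ => ?_
          split_ifs
          · exact div_nonneg (hm z) hs0.le
          · exact le_rfl
      _ = ∑ y ∈ F, ((F.filter fun x => dist y x ≤ R).card : ℝ) * (m y / s) := by
          rw [Finset.sum_comm]
          refine Finset.sum_congr rfl fun y _ => ?_
          rw [← Finset.sum_filter, Finset.sum_const, nsmul_eq_mul]
      _ ≤ ∑ y ∈ F, N * (m y / s) := Finset.sum_le_sum fun y hy =>
          mul_le_mul_of_nonneg_right (hN y hy) (div_nonneg (hm y) hs0.le)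
      _ = N / s := by rw [← Finset.mul_sum, ← Finset.sum_div, hm1]; ring
  have hdiff : ∀ S : Finset X, ∑ x ∈ S, m x - c * a / 8 ≤ ∑ x ∈ S \ L, m x := fun S => by
    have h1 := Finset.sum_inter_add_sum_sdiff S L m
    have h2 : ∑ x ∈ S ∩ L, m x ≤ ∑ x ∈ L, m x :=
      Finset.sum_le_sum_of_subset_of_nonneg Finset.inter_subset_right fun x _ _ => hm x
    linarith
  have hca : c * a ≤ a := mul_le_of_le_one_left ha.le hc1.le
  have h1 := hdiff A
  -- Dropping `L` may lower the measure below `a` but not below `a / 2`, hence the threshold in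
  -- `hexp`.
  have h2 := hexp (A \ L) (Finset.sdiff_subset.trans hAF) (by linarith)
    ((Finset.sum_le_sum_of_subset_of_nonneg Finset.sdiff_subset fun x _ _ => hm x).trans hA2)
  have h3 := hdiff (bdry F (A \ L) R)
  -- Removing `L` again keeps `B` outside `A`. Each `y ∈ B` has a neighbour `x ∈ A \ L`, so `m y ≤ s
  -- * m x` and the edge between them weighs at least `m y / s`.
  set B := bdry F (A \ L) R \ L with hB
  have h4 : c * a / 4 ≤ ∑ x ∈ B, m x := by nlinarith
  have hBA : B ⊆ F \ A := fun y hy => by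
    obtain ⟨hy1, hy2⟩ := Finset.mem_sdiff.1 hy
    obtain ⟨hyF, hyA, -⟩ := mem_bdry.1 hy1
    exact Finset.mem_sdiff.2 ⟨hyF, fun h => hyA (Finset.mem_sdiff.2 ⟨h, hy2⟩)⟩
  have hw := minWeight_nonneg (R := R) hm
  calc c * a / (4 * s) = c * a / 4 / s := by rw [div_div]
    _ ≤ (∑ x ∈ B, m x) / s := by gcongr
    _ = ∑ y ∈ B, m y / s := Finset.sum_div _ _ _
    _ ≤ ∑ y ∈ B, ∑ x ∈ A, minWeight m R x y := by
        refine Finset.sum_le_sum fun y hy => ?_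
        obtain ⟨hyF, -, x, hx, hxy⟩ := mem_bdry.1 (Finset.mem_sdiff.1 hy).1
        obtain ⟨hxA, hxL⟩ := Finset.mem_sdiff.1 hx
        refine le_trans ?_ (Finset.single_le_sum (f := fun x => minWeight m R x y)
          (fun z _ => hw z y) hxA)
        rw [dist_comm] at hxy
        have h5 : m y ≤ s * m x := by
          by_contra h
          exact hxL (Finset.mem_filter.2 ⟨hAF hxA, y, hyF, hxy, not_le.1 h⟩)
        simp only [minWeight, if_pos hxy]
        refine le_min ?_ (div_le_self (hm y) hs)
        rw [div_le_iff₀ hs0]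
        linarith
    _ ≤ ∑ y ∈ F \ A, ∑ x ∈ A, minWeight m R x y :=
        Finset.sum_le_sum_of_subset_of_nonneg hBA fun y _ _ => Finset.sum_nonneg fun x _ => hw x y
    _ = flow (minWeight m R) A (F \ A) := Finset.sum_comm

end Weights

/-! ### Operators on `ℓ²(X)` given by finitely supported real kernels -/

section Kernel

variable {X : Type*}

/-- The operator on `ℓ²(X)` with matrix entries `s x y` for `x, y ∈ Y` and zero entries
elsewhere. -/
noncomputable def kerOp (Y : Finset X) (s : X → X → ℝ) : Ell2 X ℂ →L[ℂ] Ell2 X ℂ := by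
  classical
  exact ∑ x ∈ Y, (lp.singleContinuousLinearMap ℂ (fun _ : X => ℂ) 2 x).comp
    (∑ y ∈ Y, (s x y : ℂ) • lp.evalCLM ℂ (fun _ : X => ℂ) 2 y)

open Classical in
theorem kerOp_apply (Y : Finset X) (s : X → X → ℝ) (η : Ell2 X ℂ) (x : X) :
    kerOp Y s η x = if x ∈ Y then ∑ y ∈ Y, (s x y : ℂ) * η y else 0 := by
  have h1 : kerOp Y s η = ∑ z ∈ Y, lp.single 2 z (∑ y ∈ Y, (s z y : ℂ) * η y) := by
    rw [kerOp, sum_apply]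
    refine Finset.sum_congr rfl fun z _ => ?_
    rw [ContinuousLinearMap.comp_apply, sum_apply,
      lp.singleContinuousLinearMap_apply]
    rfl
  rw [h1, lp.coeFn_sum, Finset.sum_apply]
  simp only [lp.single_apply, Pi.single_apply]
  rw [Finset.sum_ite_eq]

theorem kerOp_apply_of_mem {Y : Finset X} {x : X} (hx : x ∈ Y) (s : X → X → ℝ) (η : Ell2 X ℂ) :
    kerOp Y s η x = ∑ y ∈ Y, (s x y : ℂ) * η y := by
  rw [kerOp_apply, if_pos hx]

theorem kerOp_apply_of_notMem {Y : Finset X} {x : X} (hx : x ∉ Y) (s : X → X → ℝ)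
    (η : Ell2 X ℂ) : kerOp Y s η x = 0 := by
  rw [kerOp_apply, if_neg hx]

theorem kerOp_congr {Y : Finset X} {s t : X → X → ℝ} (h : ∀ x ∈ Y, ∀ y ∈ Y, s x y = t x y) :
    kerOp Y s = kerOp Y t := by
  refine ContinuousLinearMap.ext fun η => lp.ext (funext fun x => ?_)
  by_cases hx : x ∈ Y
  · rw [kerOp_apply_of_mem hx, kerOp_apply_of_mem hx]
    exact Finset.sum_congr rfl fun y hy => by rw [h x hx y hy]
  · rw [kerOp_apply_of_notMem hx, kerOp_apply_of_notMem hx]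

theorem kerOp_sub (Y : Finset X) (s t : X → X → ℝ) :
    kerOp Y s - kerOp Y t = kerOp Y fun x y => s x y - t x y := by
  refine ContinuousLinearMap.ext fun η => lp.ext (funext fun x => ?_)
  rw [sub_apply, lp.coeFn_sub, Pi.sub_apply]
  by_cases hx : x ∈ Y
  · rw [kerOp_apply_of_mem hx, kerOp_apply_of_mem hx, kerOp_apply_of_mem hx,
      ← Finset.sum_sub_distrib]
    exact Finset.sum_congr rfl fun y _ => by push_cast; ring
  · rw [kerOp_apply_of_notMem hx, kerOp_apply_of_notMem hx, kerOp_apply_of_notMem hx, sub_zero]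

theorem kerOp_mul (Y : Finset X) (s t : X → X → ℝ) :
    kerOp Y s * kerOp Y t = kerOp Y fun x y => ∑ z ∈ Y, s x z * t z y := by
  refine ContinuousLinearMap.ext fun η => lp.ext (funext fun x => ?_)
  change kerOp Y s (kerOp Y t η) x = _
  by_cases hx : x ∈ Y
  · rw [kerOp_apply_of_mem hx, kerOp_apply_of_mem hx]
    calc _ = ∑ z ∈ Y, ∑ y ∈ Y, (s x z : ℂ) * ((t z y : ℂ) * η y) :=
          Finset.sum_congr rfl fun z hz => by rw [kerOp_apply_of_mem hz, Finset.mul_sum]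
      _ = ∑ y ∈ Y, ∑ z ∈ Y, (s x z : ℂ) * ((t z y : ℂ) * η y) := Finset.sum_comm
      _ = _ := Finset.sum_congr rfl fun y _ => by
          push_cast
          rw [Finset.sum_mul]
          exact Finset.sum_congr rfl fun z _ => by ring
  · rw [kerOp_apply_of_notMem hx, kerOp_apply_of_notMem hx]

open Classical in
theorem kerOp_eq_of_subset {Y F : Finset X} (h : Y ⊆ F) (s : X → X → ℝ) :
    kerOp Y s = kerOp F fun x y => if x ∈ Y then if y ∈ Y then s x y else 0 else 0 := by
  refine ContinuousLinearMap.ext fun η => lp.ext (funext fun x => ?_)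
  by_cases hx : x ∈ Y
  · rw [kerOp_apply_of_mem hx, kerOp_apply_of_mem (h hx)]
    refine Finset.sum_subset_zero_on_sdiff h (fun y hy => ?_) fun y hy => by simp [hx, hy]
    simp [(Finset.mem_sdiff.1 hy).2]
  · rw [kerOp_apply_of_notMem hx]
    by_cases hxF : x ∈ F
    · rw [kerOp_apply_of_mem hxF]
      exact (Finset.sum_eq_zero fun y _ => by simp [hx]).symm
    · rw [kerOp_apply_of_notMem hxF]

theorem propagationLE_kerOp [MetricSpace X] {Y : Finset X} {s : X → X → ℝ} {R : ℝ}
    (h : ∀ x y, s x y ≠ 0 → dist x y ≤ R) : PropagationLE (kerOp Y s) R := by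
  intro η x hx
  by_cases hxY : x ∈ Y
  · rw [kerOp_apply_of_mem hxY]
    refine Finset.sum_eq_zero fun y _ => ?_
    by_cases hs : s x y = 0
    · rw [hs, Complex.ofReal_zero, zero_mul]
    · rw [hx y (h x y hs), mul_zero]
  · exact kerOp_apply_of_notMem hxY s η

/-- Polarise: with `g` the image of `f`, the form at `g + θ f` minus that at `g - θ f` is `4 θ ∑
g²`, while the hypothesis and the parallelogram law bound it by `θ (2 ∑ g² + 2 θ² ∑ f²)`. -/
theorem sum_sq_le_of_abs_form_le {Y : Finset X} {s : X → X → ℝ} {θ : ℝ} (hθ : 0 < θ)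
    (hs : ∀ x y, s x y = s y x)
    (hform : ∀ f : X → ℝ, |∑ x ∈ Y, ∑ y ∈ Y, s x y * (f x * f y)| ≤ θ * ∑ x ∈ Y, f x ^ 2)
    (f : X → ℝ) : ∑ x ∈ Y, (∑ y ∈ Y, s x y * f y) ^ 2 ≤ θ ^ 2 * ∑ x ∈ Y, f x ^ 2 := by
  set g : X → ℝ := fun x => ∑ y ∈ Y, s x y * f y with hg
  have h1 := (abs_le.1 (hform fun x => g x + θ * f x)).2
  have h2 := (abs_le.1 (hform fun x => g x - θ * f x)).1
  have h3 : ∑ x ∈ Y, ∑ y ∈ Y, s x y * ((g x + θ * f x) * (g y + θ * f y)) -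
      ∑ x ∈ Y, ∑ y ∈ Y, s x y * ((g x - θ * f x) * (g y - θ * f y)) =
      4 * θ * ∑ x ∈ Y, g x ^ 2 := by
    have h4 : ∑ x ∈ Y, g x ^ 2 = ∑ x ∈ Y, ∑ y ∈ Y, s x y * (g x * f y) :=
      Finset.sum_congr rfl fun x _ => by
        rw [sq]
        nth_rewrite 2 [hg]
        rw [Finset.mul_sum]
        exact Finset.sum_congr rfl fun y _ => by ring
    have h5 : ∑ x ∈ Y, ∑ y ∈ Y, s x y * (g x * f y) = ∑ x ∈ Y, ∑ y ∈ Y, s x y * (f x * g y) := by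
      rw [Finset.sum_comm]
      exact Finset.sum_congr rfl fun x _ => Finset.sum_congr rfl fun y _ => by rw [hs y x]; ring
    have h6 : 4 * θ * ∑ x ∈ Y, g x ^ 2 = 2 * θ * ∑ x ∈ Y, ∑ y ∈ Y, s x y * (g x * f y) +
        2 * θ * ∑ x ∈ Y, ∑ y ∈ Y, s x y * (f x * g y) := by
      rw [← h5, ← h4]; ring
    rw [h6]
    simp only [Finset.mul_sum, ← Finset.sum_add_distrib, ← Finset.sum_sub_distrib]
    exact Finset.sum_congr rfl fun x _ => Finset.sum_congr rfl fun y _ => by ring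
  have h7 : ∑ x ∈ Y, (g x + θ * f x) ^ 2 + ∑ x ∈ Y, (g x - θ * f x) ^ 2 =
      2 * ∑ x ∈ Y, g x ^ 2 + 2 * θ ^ 2 * ∑ x ∈ Y, f x ^ 2 := by
    simp only [Finset.mul_sum, ← Finset.sum_add_distrib]
    exact Finset.sum_congr rfl fun x _ => by ring
  have h8 : θ * (4 * ∑ x ∈ Y, g x ^ 2) ≤
      θ * (2 * ∑ x ∈ Y, g x ^ 2 + 2 * θ ^ 2 * ∑ x ∈ Y, f x ^ 2) := by
    rw [← h7]; linarith
  have h9 := le_of_mul_le_mul_left h8 hθ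
  linarith

/-- The norm of a symmetric real kernel operator is bounded by its numerical radius. -/
theorem norm_kerOp_le {Y : Finset X} {s : X → X → ℝ} {θ : ℝ} (hθ : 0 < θ)
    (hs : ∀ x y, s x y = s y x)
    (hform : ∀ f : X → ℝ, |∑ x ∈ Y, ∑ y ∈ Y, s x y * (f x * f y)| ≤ θ * ∑ x ∈ Y, f x ^ 2) :
    ‖kerOp Y s‖ ≤ θ := by
  refine ContinuousLinearMap.opNorm_le_bound _ hθ.le fun η => ?_
  refine le_of_sq_le_sq ?_ (by positivity)
  rw [norm_sq_eq_sum fun x hx => kerOp_apply_of_notMem hx s η]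
  -- A real kernel acts separately on real and imaginary parts.
  have hnsq : ∀ z : ℂ, ‖z‖ ^ 2 = z.re ^ 2 + z.im ^ 2 := fun z => by
    rw [← Complex.normSq_eq_norm_sq, Complex.normSq_apply]; ring
  have h1 : ∀ x ∈ Y, ‖kerOp Y s η x‖ ^ 2 =
      (∑ y ∈ Y, s x y * (η y).re) ^ 2 + (∑ y ∈ Y, s x y * (η y).im) ^ 2 := by
    intro x hx
    rw [hnsq, kerOp_apply_of_mem hx, Complex.re_sum, Complex.im_sum]
    simp
  rw [Finset.sum_congr rfl h1, Finset.sum_add_distrib]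
  have h2 := sum_sq_le_of_abs_form_le hθ hs hform fun y => (η y).re
  have h3 := sum_sq_le_of_abs_form_le hθ hs hform fun y => (η y).im
  have h4 : ∑ x ∈ Y, (η x).re ^ 2 + ∑ x ∈ Y, (η x).im ^ 2 ≤ ‖η‖ ^ 2 := by
    rw [← Finset.sum_add_distrib]
    refine le_trans (le_of_eq ?_) (sum_norm_sq_le η Y)
    exact Finset.sum_congr rfl fun x _ => (hnsq _).symm
  have h5 := mul_le_mul_of_nonneg_left h4 (sq_nonneg θ)
  rw [mul_pow]
  linarith

end Kernel

/-! ### Random walks on measured expanders -/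

section Walk

variable {X : Type*}

open Classical in
/-- The kernel of the lazy random walk with edge weights `w`, conjugated by the square root `r` of
the stationary measure. -/
noncomputable def walkKernel (Y : Finset X) (w : X → X → ℝ) (r : X → ℝ) (D : ℝ) (x y : X) : ℝ :=
  (if x = y then 1 - (∑ z ∈ Y, w x z) / (2 * D * r x ^ 2) else 0) + w x y / (2 * D * r x * r y)

/-- The kernel of the projection onto the line spanned by the restriction of `r` to `Y`. -/
noncomputable def projKernel (Y : Finset X) (r : X → ℝ) (x y : X) : ℝ :=
  r x * r y / ∑ z ∈ Y, r z ^ 2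

variable {Y : Finset X} {w : X → X → ℝ} {r : X → ℝ} {D : ℝ}

theorem walkKernel_comm (hs : ∀ x y, w x y = w y x) (x y : X) :
    walkKernel Y w r D x y = walkKernel Y w r D y x := by
  by_cases h : x = y
  · rw [h]
  · rw [walkKernel, walkKernel, if_neg h, if_neg (Ne.symm h), hs x y]
    congr 2
    ring

theorem projKernel_comm (x y : X) : projKernel Y r x y = projKernel Y r y x := by
  rw [projKernel, projKernel, mul_comm]

/-- The diagonal term loses exactly the outgoing weight that the off-diagonal sum restores, so `r`
is stationary. -/
theorem sum_walkKernel_mul (hD : 0 < D) (hr : ∀ x ∈ Y, 0 < r x) {x : X} (hx : x ∈ Y) :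
    ∑ y ∈ Y, walkKernel Y w r D x y * r y = r x := by
  classical
  have hrx := (hr x hx).ne'
  simp only [walkKernel, add_mul, Finset.sum_add_distrib, ite_mul, zero_mul]
  rw [Finset.sum_ite_eq, if_pos hx]
  have h1 : ∑ y ∈ Y, w x y / (2 * D * r x * r y) * r y = (∑ y ∈ Y, w x y) / (2 * D * r x) := by
    rw [Finset.sum_div]
    refine Finset.sum_congr rfl fun y hy => ?_
    have := (hr y hy).ne'
    field_simp
  rw [h1]
  field_simp
  ring

theorem walk_mul_proj (hD : 0 < D) (hr : ∀ x ∈ Y, 0 < r x) :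
    kerOp Y (walkKernel Y w r D) * kerOp Y (projKernel Y r) = kerOp Y (projKernel Y r) := by
  rw [kerOp_mul]
  refine kerOp_congr fun x hx y _ => ?_
  calc _ = (∑ z ∈ Y, walkKernel Y w r D x z * r z) * (r y / ∑ z ∈ Y, r z ^ 2) := by
        rw [Finset.sum_mul]
        exact Finset.sum_congr rfl fun z _ => by rw [projKernel]; ring
    _ = _ := by rw [sum_walkKernel_mul hD hr hx, projKernel]; ring

theorem proj_mul_walk (hs : ∀ x y, w x y = w y x) (hD : 0 < D) (hr : ∀ x ∈ Y, 0 < r x) :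
    kerOp Y (projKernel Y r) * kerOp Y (walkKernel Y w r D) = kerOp Y (projKernel Y r) := by
  rw [kerOp_mul]
  refine kerOp_congr fun x _ y hy => ?_
  calc _ = (∑ z ∈ Y, walkKernel Y w r D y z * r z) * (r x / ∑ z ∈ Y, r z ^ 2) := by
        rw [Finset.sum_mul]
        exact Finset.sum_congr rfl fun z _ => by rw [projKernel, walkKernel_comm hs z y]; ring
    _ = _ := by rw [sum_walkKernel_mul hD hr hy, projKernel]; ring

theorem proj_mul_proj (hM : 0 < ∑ z ∈ Y, r z ^ 2) :
    kerOp Y (projKernel Y r) * kerOp Y (projKernel Y r) = kerOp Y (projKernel Y r) := by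
  rw [kerOp_mul]
  refine kerOp_congr fun x _ y _ => ?_
  have h := hM.ne'
  calc _ = (∑ z ∈ Y, r z ^ 2) * (r x * r y / (∑ z ∈ Y, r z ^ 2) ^ 2) := by
        rw [Finset.sum_mul]
        exact Finset.sum_congr rfl fun z _ => by simp only [projKernel]; ring
    _ = _ := by rw [projKernel]; field_simp

/-- Since `T p = p T = p = p²`, all cross terms collapse. The exponent is `k + 1` because the zeroth
power would leave `1 - p` against `1`. -/
theorem walk_pow_sub_proj (hs : ∀ x y, w x y = w y x) (hD : 0 < D) (hr : ∀ x ∈ Y, 0 < r x)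
    (hM : 0 < ∑ z ∈ Y, r z ^ 2) (k : ℕ) :
    kerOp Y (walkKernel Y w r D) ^ (k + 1) - kerOp Y (projKernel Y r) =
      (kerOp Y (walkKernel Y w r D) - kerOp Y (projKernel Y r)) ^ (k + 1) := by
  set T := kerOp Y (walkKernel Y w r D)
  set p := kerOp Y (projKernel Y r)
  have h1 : T * p = p := walk_mul_proj hD hr
  have h2 : p * T = p := proj_mul_walk hs hD hr
  have h3 : p * p = p := proj_mul_proj hM
  have h4 : ∀ j : ℕ, T ^ j * p = p := fun j => by
    induction j with
    | zero => rw [pow_zero, one_mul]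
    | succ j ih => rw [pow_succ, mul_assoc, h1, ih]
  induction k with
  | zero => simp
  | succ k ih =>
    rw [pow_succ (T - p), ← ih, sub_mul, mul_sub, mul_sub, h2, h3, h4, ← pow_succ]
    abel

/-- Expand the square in the Dirichlet form of `f / r`. The factor `4 * D` combines the laziness `2
* D` with the double counting of edges. -/
theorem walk_form_eq (hs : ∀ x y, w x y = w y x) (hD : 0 < D) (hr : ∀ x ∈ Y, 0 < r x)
    (f : X → ℝ) :
    ∑ x ∈ Y, ∑ y ∈ Y, walkKernel Y w r D x y * (f x * f y) =
      ∑ x ∈ Y, f x ^ 2 - dirichlet w Y (fun x => f x / r x) / (4 * D) := by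
  have h1 : dirichlet w Y (fun x => f x / r x) =
      2 * ∑ x ∈ Y, (∑ z ∈ Y, w x z) * (f x / r x) ^ 2 -
        2 * ∑ x ∈ Y, ∑ y ∈ Y, w x y * (f x / r x * (f y / r y)) := by
    have h2 : ∑ x ∈ Y, ∑ y ∈ Y, w x y * (f y / r y) ^ 2 =
        ∑ x ∈ Y, (∑ z ∈ Y, w x z) * (f x / r x) ^ 2 := by
      rw [Finset.sum_comm]
      refine Finset.sum_congr rfl fun x _ => ?_
      rw [Finset.sum_mul]
      exact Finset.sum_congr rfl fun y _ => by rw [hs]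
    have h3 : ∑ x ∈ Y, ∑ y ∈ Y, w x y * (f x / r x) ^ 2 =
        ∑ x ∈ Y, (∑ z ∈ Y, w x z) * (f x / r x) ^ 2 :=
      Finset.sum_congr rfl fun x _ => by rw [Finset.sum_mul]
    rw [two_mul]
    nth_rewrite 1 [← h2]
    rw [← h3, Finset.mul_sum, ← Finset.sum_add_distrib, ← Finset.sum_sub_distrib]
    refine Finset.sum_congr rfl fun x _ => ?_
    rw [Finset.mul_sum, ← Finset.sum_add_distrib, ← Finset.sum_sub_distrib]
    exact Finset.sum_congr rfl fun y _ => by ring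
  have h4 : ∀ x ∈ Y, ∑ y ∈ Y, walkKernel Y w r D x y * (f x * f y) =
      f x ^ 2 - (∑ z ∈ Y, w x z) * (f x / r x) ^ 2 / (2 * D) +
        (∑ y ∈ Y, w x y * (f x / r x * (f y / r y))) / (2 * D) := by
    intro x hx
    classical
    have hrx := (hr x hx).ne'
    simp only [walkKernel, add_mul, Finset.sum_add_distrib, ite_mul, zero_mul]
    rw [Finset.sum_ite_eq, if_pos hx]
    congr 1
    · field_simp
    · rw [Finset.sum_div]
      refine Finset.sum_congr rfl fun y hy => ?_
      have := (hr y hy).ne'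
      field_simp
  rw [Finset.sum_congr rfl h4, Finset.sum_add_distrib, Finset.sum_sub_distrib, h1,
    ← Finset.sum_div, ← Finset.sum_div]
  field_simp
  ring

/-- The random walk on an expander converges to its stationary projection at a rate depending
only on the Cheeger constant. -/
theorem norm_walk_sub_proj_le [DecidableEq X] {c : ℝ} (hw : ∀ x y, 0 ≤ w x y)
    (hs : ∀ x y, w x y = w y x) (hr : ∀ x ∈ Y, 0 < r x) (hD0 : 1 ≤ D)
    (hD : ∀ x ∈ Y, ∑ y ∈ Y, w x y ≤ D * r x ^ 2) (hc0 : 0 < c) (hc1 : c ≤ 1)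
    (hM : 0 < ∑ z ∈ Y, r z ^ 2)
    (hc : ∀ A ⊆ Y, 2 * ∑ x ∈ A, r x ^ 2 ≤ ∑ x ∈ Y, r x ^ 2 →
      c * ∑ x ∈ A, r x ^ 2 ≤ flow w A (Y \ A)) :
    ‖kerOp Y (walkKernel Y w r D) - kerOp Y (projKernel Y r)‖ ≤ 1 - c ^ 2 / (4 * D ^ 2) := by
  have hD' : 0 < D := one_pos.trans_le hD0
  have hθ : c ^ 2 / (4 * D ^ 2) ≤ 1 / 4 := by
    rw [div_le_div_iff₀ (by positivity) (by norm_num)]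
    nlinarith
  rw [kerOp_sub]
  refine norm_kerOp_le (by linarith) (fun x y => by
    rw [walkKernel_comm hs, projKernel_comm]) fun f => ?_
  set M := ∑ z ∈ Y, r z ^ 2 with hMdef
  -- `μ` is the mean of `f / r` for the measure `r²`, and `V` its unnormalised variance. The form of
  -- walk minus projection is `V - E / (4 D)`: Poincaré bounds it above by `(1 - c² / (4 D²)) V`,
  -- and `dirichlet_le` bounds it below by `0`.
  set μ := (∑ x ∈ Y, r x * f x) / M with hμ
  set E := dirichlet w Y (fun x => f x / r x) with hE
  set V := ∑ x ∈ Y, (f x / r x - μ) ^ 2 * r x ^ 2 with hV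
  have hμM : ∑ x ∈ Y, r x * f x = μ * M := by rw [hμ]; field_simp
  have h1 : ∑ x ∈ Y, ∑ y ∈ Y, (walkKernel Y w r D x y - projKernel Y r x y) * (f x * f y) =
      V - E / (4 * D) := by
    have h2 : ∑ x ∈ Y, ∑ y ∈ Y, projKernel Y r x y * (f x * f y) = μ ^ 2 * M := by
      have h3 : μ ^ 2 * M = (∑ x ∈ Y, r x * f x) * (∑ x ∈ Y, r x * f x) / M := by
        rw [hμM]; field_simp
      rw [h3, Finset.sum_mul_sum, Finset.sum_div]
      refine Finset.sum_congr rfl fun x _ => ?_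
      rw [Finset.sum_div]
      exact Finset.sum_congr rfl fun y _ => by rw [projKernel]; ring
    have h4 : V = ∑ x ∈ Y, f x ^ 2 - μ ^ 2 * M := by
      have h5 : V = ∑ x ∈ Y, (f x ^ 2 - 2 * μ * (r x * f x) + μ ^ 2 * r x ^ 2) :=
        Finset.sum_congr rfl fun x hx => by
          have := (hr x hx).ne'
          field_simp
          ring
      rw [h5, Finset.sum_add_distrib, Finset.sum_sub_distrib, ← Finset.mul_sum,
        ← Finset.mul_sum, hμM]
      ring
    simp only [sub_mul, Finset.sum_sub_distrib]
    rw [h2, walk_form_eq hs hD' hr, h4]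
    ring
  have hE' : dirichlet w Y (fun x => f x / r x - μ) = E :=
    Finset.sum_congr rfl fun x _ => Finset.sum_congr rfl fun y _ => by ring
  have hmean : ∑ x ∈ Y, (f x / r x - μ) * r x ^ 2 = 0 := by
    have h5 : ∑ x ∈ Y, (f x / r x - μ) * r x ^ 2 = ∑ x ∈ Y, (r x * f x - μ * r x ^ 2) :=
      Finset.sum_congr rfl fun x hx => by
        have := (hr x hx).ne'
        field_simp
    rw [h5, Finset.sum_sub_distrib, ← Finset.mul_sum, hμM]
    ring
  have hm : ∀ x, 0 ≤ r x ^ 2 := fun x => sq_nonneg _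
  have h6 := poincare hw hs hm hD' hD hc0 hc hmean
  have h7 := dirichlet_le hw hs hD fun x => f x / r x - μ
  rw [hE'] at h6 h7
  change c ^ 2 * V ≤ D * E at h6
  change E ≤ 4 * D * V at h7
  have hV0 : 0 ≤ V := Finset.sum_nonneg fun x _ => mul_nonneg (sq_nonneg _) (sq_nonneg _)
  have h8 : V ≤ ∑ x ∈ Y, f x ^ 2 := by
    have h5 : V = ∑ x ∈ Y, (f x ^ 2 - 2 * μ * (r x * f x) + μ ^ 2 * r x ^ 2) :=
      Finset.sum_congr rfl fun x hx => by
        have := (hr x hx).ne'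
        field_simp
        ring
    rw [h5, Finset.sum_add_distrib, Finset.sum_sub_distrib, ← Finset.mul_sum,
      ← Finset.mul_sum, hμM]
    nlinarith [mul_nonneg (sq_nonneg μ) hM.le]
  have h9 : E / (4 * D) ≤ V := by
    rw [div_le_iff₀ (by positivity)]
    linarith
  have h10 : c ^ 2 / (4 * D ^ 2) * V ≤ E / (4 * D) := by
    rw [div_mul_eq_mul_div, div_le_div_iff₀ (by positivity) (by positivity)]
    nlinarith
  rw [h1, abs_of_nonneg (by linarith)]
  have h11 : (1 - c ^ 2 / (4 * D ^ 2)) * V ≤ (1 - c ^ 2 / (4 * D ^ 2)) * ∑ x ∈ Y, f x ^ 2 :=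
    mul_le_mul_of_nonneg_left h8 (by linarith)
  linarith

theorem sq_sum_mul_le {f : X → ℝ} (S : Finset X) :
    (∑ x ∈ S, r x * f x) ^ 2 ≤ (∑ x ∈ S, r x ^ 2) * ∑ x ∈ S, f x ^ 2 :=
  Finset.sum_mul_sq_le_sq_mul_sq _ _ _

/-- Restricting a unit vector to a set of almost full measure changes the corresponding rank-one
projection only slightly. -/
theorem norm_proj_sub_rankOne_le {F : Finset X} {δ : ℝ} (hYF : Y ⊆ F) (hδ : 0 < δ) (hδ1 : δ ≤ 1 / 2)
    (h1 : ∑ x ∈ F, r x ^ 2 = 1) (hY : 1 - δ ^ 2 ≤ ∑ x ∈ Y, r x ^ 2) :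
    ‖kerOp Y (projKernel Y r) - kerOp F fun x y => r x * r y‖ ≤ 3 * δ := by
  classical
  rw [kerOp_eq_of_subset hYF, kerOp_sub]
  refine norm_kerOp_le (by positivity) (fun x y => ?_) fun f => ?_
  · by_cases hx : x ∈ Y <;> by_cases hy : y ∈ Y <;> simp [hx, hy, projKernel, mul_comm]
  set M := ∑ x ∈ Y, r x ^ 2 with hM
  set B := ∑ x ∈ Y, r x * f x with hB
  set C := ∑ x ∈ F \ Y, r x * f x with hC
  set N := ∑ x ∈ F, f x ^ 2 with hN
  have hAB : ∑ x ∈ F, r x * f x = C + B := (Finset.sum_sdiff hYF).symm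
  have hM0 : 0 < M := by nlinarith
  have hM1 : M + ∑ x ∈ F \ Y, r x ^ 2 = 1 := by
    rw [← h1, ← Finset.sum_sdiff hYF, add_comm]
  have hZ0 : 0 ≤ ∑ x ∈ F \ Y, r x ^ 2 := Finset.sum_nonneg fun _ _ => sq_nonneg _
  have hN0 : 0 ≤ N := Finset.sum_nonneg fun _ _ => sq_nonneg _
  have hsub : ∀ S ⊆ F, ∑ x ∈ S, f x ^ 2 ≤ N := fun S hS =>
    Finset.sum_le_sum_of_subset_of_nonneg hS fun _ _ _ => sq_nonneg _
  have hform : ∑ x ∈ F, ∑ y ∈ F, ((if x ∈ Y then if y ∈ Y then projKernel Y r x y else 0 else 0) -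
      r x * r y) * (f x * f y) = B ^ 2 / M - (C + B) ^ 2 := by
    have h2 : ∑ x ∈ F, ∑ y ∈ F, r x * r y * (f x * f y) = (C + B) ^ 2 := by
      rw [← hAB, sq, Finset.sum_mul_sum]
      exact Finset.sum_congr rfl fun x _ => Finset.sum_congr rfl fun y _ => by ring
    have h3 : ∑ x ∈ F, ∑ y ∈ F,
        (if x ∈ Y then if y ∈ Y then projKernel Y r x y else 0 else 0) * (f x * f y) =
        B ^ 2 / M := by
      calc _ = ∑ x ∈ Y, ∑ y ∈ Y, projKernel Y r x y * (f x * f y) := by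
            symm
            refine Finset.sum_subset_zero_on_sdiff hYF (fun x hx => ?_) fun x hx => ?_
            · simp [(Finset.mem_sdiff.1 hx).2]
            · refine Finset.sum_subset_zero_on_sdiff hYF (fun y hy => ?_) fun y hy => ?_
              · simp [(Finset.mem_sdiff.1 hy).2]
              · simp [hx, hy]
        _ = B ^ 2 / M := by
            rw [sq, hB, Finset.sum_mul_sum, Finset.sum_div]
            refine Finset.sum_congr rfl fun x _ => ?_
            rw [Finset.sum_div]
            exact Finset.sum_congr rfl fun y _ => by rw [projKernel]; ring
    simp only [sub_mul, Finset.sum_sub_distrib]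
    rw [h2, h3]
  rw [hform]
  -- The error splits into a normalisation term `B² / M - B² ≤ δ N`, from `1 - M ≤ δ² ≤ δ`, and a
  -- term `C (C + 2 B)` from the discarded points, of size at most `2 δ N`.
  have hB2 : B ^ 2 ≤ M * N := (sq_sum_mul_le Y).trans
    (mul_le_mul_of_nonneg_left (hsub Y hYF) hM0.le)
  have hC2 : C ^ 2 ≤ δ ^ 2 * N := by
    refine (sq_sum_mul_le (F \ Y)).trans ?_
    exact mul_le_mul (by linarith) (hsub _ Finset.sdiff_subset)
      (Finset.sum_nonneg fun _ _ => sq_nonneg _) (sq_nonneg _)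
  have hA2 : (C + B) ^ 2 ≤ N := by
    rw [← hAB]
    refine (sq_sum_mul_le F).trans ?_
    rw [h1, one_mul]
  have hBN : B ^ 2 ≤ N := hB2.trans (mul_le_of_le_one_left hN0 (by linarith))
  have hCAB : |C * (C + B + B)| ≤ 2 * δ * N := by
    refine abs_le_of_sq_le_sq ?_ (by positivity)
    have h2 : (C + B + B) ^ 2 ≤ 4 * N := by nlinarith [sq_nonneg (C + B - B)]
    calc (C * (C + B + B)) ^ 2 = C ^ 2 * (C + B + B) ^ 2 := by ring
      _ ≤ (δ ^ 2 * N) * (4 * N) := mul_le_mul hC2 h2 (sq_nonneg _) (by positivity)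
      _ = _ := by ring
  have hBM : B ^ 2 / M - B ^ 2 ≤ δ * N := by
    have h2 : B ^ 2 / M - B ^ 2 = B ^ 2 / M * (1 - M) := by field_simp
    have h3 : B ^ 2 / M ≤ N := by rw [div_le_iff₀ hM0]; linarith
    rw [h2]
    calc _ ≤ N * δ := mul_le_mul h3 (by nlinarith) (by linarith) hN0
      _ = _ := mul_comm _ _
  have hBM0 : 0 ≤ B ^ 2 / M - B ^ 2 := by
    have h2 : B ^ 2 / M - B ^ 2 = B ^ 2 / M * (1 - M) := by field_simp
    rw [h2]
    exact mul_nonneg (div_nonneg (sq_nonneg _) hM0.le) (by linarith)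
  have hsplit : B ^ 2 / M - (C + B) ^ 2 = (B ^ 2 / M - B ^ 2) - C * (C + B + B) := by ring
  rw [hsplit]
  rw [abs_le] at hCAB ⊢
  constructor <;> linarith [hCAB.1, hCAB.2, mul_nonneg hδ.le hN0]

end Walk

/-! ### Approximation by operators of finite propagation -/

section Approximation

variable {X : Type*} [MetricSpace X]

open Classical in
-- The approximant is a power of the lazy walk on the expanding part `Y` of `F`, where at most `δ²`
-- of the measure is lost. The bounds depend on `F` only through the listed constants, hence can be
-- uniform over all blocks.
theorem Expands.exists_propagationLE_norm_sub_le {F : Finset X} {r : X → ℝ} (hr : ∀ x, 0 ≤ r x)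
    (hr1 : ∑ x ∈ F, r x ^ 2 = 1) {N δ c R s κ : ℝ} (hR : 0 ≤ R) (hN1 : 1 ≤ N)
    (hN : ∀ x ∈ F, ((F.filter fun y => dist x y ≤ R).card : ℝ) ≤ N)
    (hδ : 0 < δ) (hδ1 : δ ≤ 1 / 2) (hc0 : 0 < c) (hc1 : c < 1) (hs : 1 ≤ s)
    (hNs : N / s ≤ c * δ ^ 2 / 8) (hκ : κ = c * δ ^ 2 / (4 * s))
    (hexp : Expands F (fun x => r x ^ 2) (δ ^ 2 / 2) c R) (k : ℕ) :
    ∃ T : Ell2 X ℂ →L[ℂ] Ell2 X ℂ, PropagationLE T ((k + 1 : ℕ) * R) ∧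
      ‖T - kerOp F fun x y => r x * r y‖ ≤
        (1 - (κ / 2) ^ 2 / (4 * N ^ 2)) ^ (k + 1) + 3 * δ := by
  set m : X → ℝ := fun x => r x ^ 2 with hm_def
  have hm : ∀ x, 0 ≤ m x := fun x => sq_nonneg _
  set w := minWeight m R with hw_def
  have hw : ∀ x y, 0 ≤ w x y := minWeight_nonneg hm
  have hws : ∀ x y, w x y = w y x := minWeight_comm
  have hδ2 : 0 < δ ^ 2 := by positivity
  have hδ4 : δ ^ 2 ≤ 1 / 4 := by nlinarith
  have hs0 : 0 < s := one_pos.trans_le hs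
  have hκ0 : 0 < κ := hκ ▸ by positivity
  have hκ1 : κ / 2 ≤ 1 := by
    have : κ ≤ 1 := by
      rw [hκ, div_le_one (by positivity)]
      nlinarith
    linarith
  obtain ⟨Y, hYF, hY1, hY2⟩ := exists_expanding_subset (w := w) (m := m) hw hws hm hr1 hκ0 hδ4
    fun A hAF hA1 hA2 => hκ ▸ hexp.le_flow hm hr1 hN hδ2 hc0 hc1 hs hNs hAF hA1 hA2
  have hM : 0 < ∑ z ∈ Y, r z ^ 2 := by
    change 1 - δ ^ 2 ≤ ∑ z ∈ Y, r z ^ 2 at hY1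
    linarith
  -- A point of mass zero carries no edge weight, contradicting the strict flow inequality for its
  -- singleton. The walk kernel divides by `r`, so this is needed.
  have hpos : ∀ x ∈ Y, 0 < r x := by
    intro x hx
    refine (hr x).lt_of_ne fun h0 => ?_
    have hmx : m x = 0 := by simp [hm_def, ← h0]
    have h1 := hY2 {x} (Finset.singleton_subset_iff.2 hx) (Finset.singleton_nonempty x) (by
      rw [Finset.sum_singleton, hmx, mul_zero]; exact hM.le)
    have h2 : flow w {x} (Y \ {x}) = 0 := by
      rw [flow, Finset.sum_singleton]
      exact Finset.sum_eq_zero fun y _ =>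
        le_antisymm ((minWeight_le_left hm x y).trans hmx.le) (hw x y)
    rw [h2, Finset.sum_singleton, hmx, mul_zero] at h1
    exact lt_irrefl _ h1
  have hdeg : ∀ x ∈ Y, ∑ y ∈ Y, w x y ≤ N * r x ^ 2 := by
    intro x hx
    refine sum_minWeight_le hm Y x (le_trans ?_ (hN x (hYF hx)))
    exact_mod_cast Finset.card_le_card (Finset.filter_subset_filter _ hYF)
  have hgap := norm_walk_sub_proj_le hw hws hpos hN1 hdeg (half_pos hκ0) hκ1 hM
    fun A hA hA2 => by
      rcases A.eq_empty_or_nonempty with rfl | hne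
      · simp [flow]
      · exact (hY2 A hA hne hA2).le
  set T := kerOp Y (walkKernel Y w r N) with hT
  have hprop : PropagationLE T R := propagationLE_kerOp fun x y hxy => by
    by_contra hd
    refine hxy ?_
    have h1 : x ≠ y := fun h => hd (by rw [h, dist_self]; exact hR)
    have h2 : w x y = 0 := if_neg hd
    rw [walkKernel, if_neg h1, h2, zero_div, add_zero]
  refine ⟨T ^ (k + 1), hprop.pow (k + 1), ?_⟩
  have h1 : T ^ (k + 1) - kerOp F (fun x y => r x * r y) =
      (T - kerOp Y (projKernel Y r)) ^ (k + 1) +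
        (kerOp Y (projKernel Y r) - kerOp F fun x y => r x * r y) := by
    rw [← walk_pow_sub_proj hws (one_pos.trans_le hN1) hpos hM k]
    abel
  rw [h1]
  refine (ContinuousLinearMap.opNorm_add_le _ _).trans (add_le_add ?_ ?_)
  · exact (norm_pow_le' (T - kerOp Y (projKernel Y r)) k.succ_pos).trans
      (pow_le_pow_left₀ (norm_nonneg _) hgap _)
  · exact norm_proj_sub_rankOne_le hYF hδ hδ1 hr1 hY1

open Classical in
theorem BoundedGeometry.exists_card_le (hX : BoundedGeometry X) {R : ℝ} (hR : 0 < R) :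
    ∃ N : ℝ, 1 ≤ N ∧ ∀ (F : Finset X) (x : X),
      ((F.filter fun y => dist x y ≤ R).card : ℝ) ≤ N := by
  obtain ⟨N, hN⟩ := hX R hR
  refine ⟨max 1 N, le_max_left _ _, fun F x => le_trans ?_ (le_max_right _ _)⟩
  have h1 : ((F.filter fun y => dist x y ≤ R : Finset X) : Set X) ⊆ Metric.closedBall x R :=
    fun y hy => by
      rw [Metric.mem_closedBall, dist_comm]
      exact (Finset.mem_filter.1 hy).2
  have h2 := (Set.encard_le_encard h1).trans (hN x)
  rw [Set.encard_coe_eq_coe_finsetCard] at h2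
  exact_mod_cast h2

variable {H : Type*} [NormedAddCommGroup H] {Xn : ℕ → Finset X} {ξ : ℕ → Ell2 X H}
  {Q : Ell2 X ℂ →L[ℂ] Ell2 X ℂ}

/-- One choice of `δ`, `c`, `R`, `N`, `s` and `k` serves all blocks, so the walk powers have a
common propagation bound and a common error. -/
theorem mem_uniformRoeAlgebra_of_measuredAsymptoticExpanders (hX : BoundedGeometry X)
    (hd : Pairwise fun n m => Disjoint (Xn n) (Xn m)) (hc : ∀ x : X, ∃ n, x ∈ Xn n)
    (hQ : IsAssociatedTo Xn Q fun n => uniformVec (ξ n))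
    (hE : MeasuredAsymptoticExpanders (fun n => Xn n) (fun n x => ‖ξ n x‖ ^ 2)) :
    Q ∈ uniformRoeAlgebra X := by
  classical
  have hr1 : ∀ n, ∑ x ∈ Xn n, ‖ξ n x‖ ^ 2 = 1 := fun n => by
    simpa [uniformVec_apply] using hQ.sum_norm_sq n
  rw [measuredAsymptoticExpanders_iff (m := fun n x => ‖ξ n x‖ ^ 2) (fun _ _ => sq_nonneg _)
    hr1] at hE
  refine (Metric.mem_closure_iff (α := Ell2 X ℂ →L[ℂ] Ell2 X ℂ)).2 fun ε hε => ?_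
  -- Restriction to the expanding part costs `3 δ ≤ ε / 4`, and the walk will cost less than `ε /
  -- 4`.
  set δ := min (1 / 2) (ε / 12) with hδ
  have hδ0 : 0 < δ := lt_min (by norm_num) (by positivity)
  have hδ1 : δ ≤ 1 / 2 := min_le_left _ _
  have hδε : δ ≤ ε / 12 := min_le_right _ _
  have hδ4 : δ ^ 2 ≤ 1 / 4 := by nlinarith
  obtain ⟨c, hc0, hc1, R, hR, hexp⟩ := hE (δ ^ 2 / 2) (by positivity) (by linarith)
  obtain ⟨N, hN1, hN⟩ := hX.exists_card_le hR
  set s := 8 * N / (c * δ ^ 2) with hs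
  have hN0 : 0 < N := one_pos.trans_le hN1
  have hs1 : 1 ≤ s := by
    rw [hs, one_le_div (by positivity)]
    nlinarith
  have hs0 : 0 < s := one_pos.trans_le hs1
  have hNs : N / s ≤ c * δ ^ 2 / 8 := le_of_eq (by rw [hs]; field_simp)
  set κ := c * δ ^ 2 / (4 * s) with hκ
  have hκ0 : 0 < κ := by positivity
  set θ := 1 - (κ / 2) ^ 2 / (4 * N ^ 2) with hθ
  have hκ1 : κ ≤ 1 := by
    rw [hκ, div_le_one (by positivity)]
    nlinarith
  have hθ1 : θ < 1 := by
    have : 0 < (κ / 2) ^ 2 / (4 * N ^ 2) := by positivity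
    linarith
  have hθ0 : 0 ≤ θ := by
    have : (κ / 2) ^ 2 / (4 * N ^ 2) ≤ 1 := by
      rw [div_le_one (by positivity)]
      nlinarith
    linarith
  obtain ⟨k, hk⟩ := exists_pow_lt_of_lt_one (by positivity : 0 < ε / 4) hθ1
  have hk' : θ ^ (k + 1) < ε / 4 := (pow_le_pow_of_le_one hθ0 hθ1.le k.le_succ).trans_lt hk
  choose T hT1 hT2 using fun n => (hexp n).exists_propagationLE_norm_sub_le
    (r := fun x => ‖ξ n x‖) (fun _ => norm_nonneg _) (hr1 n) hR.le hN1 (fun x _ => hN (Xn n) x)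
    hδ0 hδ1 hc0 hc1 hs1 hNs hκ k
  -- Summing the errors rather than the walk powers gives the norm bound at once; `Q + E` then acts
  -- on block `n` as `T n`.
  obtain ⟨E, hE1, hE2⟩ := exists_directSum hd hc
    (fun n => T n - kerOp (Xn n) fun x y => ‖ξ n x‖ * ‖ξ n y‖) (C := ε / 2) (by positivity)
    fun n => (hT2 n).trans (by linarith)
  have hblock : ∀ n (η : Ell2 X ℂ), ∀ x ∈ Xn n,
      (Q + E) η x = T n (chi (Xn n : Set X) η) x := by
    intro n η x hx
    have h1 : Q η x = kerOp (Xn n) (fun x y => ‖ξ n x‖ * ‖ξ n y‖) (chi (Xn n : Set X) η) x := by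
      rw [hQ.apply_of_mem hd hc η hx, kerOp_apply_of_mem hx, inner_eq_sum (hQ.support n),
        smul_eq_mul, Finset.sum_mul]
      refine Finset.sum_congr rfl fun y hy => ?_
      rw [chi_apply_of_mem (by simpa using hy)]
      simp only [uniformVec_apply, RCLike.inner_apply, Complex.conj_ofReal, Complex.ofReal_mul]
      ring
    have h2 := hE2 n η x hx
    rw [sub_apply, lp.coeFn_sub, Pi.sub_apply] at h2
    rw [add_apply, lp.coeFn_add, Pi.add_apply, h1, h2]
    ring
  refine ⟨Q + E, PropagationLE.finitePropagation (R := (k + 1 : ℕ) * R) fun η x hx => ?_, ?_⟩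
  · obtain ⟨n, hn⟩ := hc x
    rw [hblock n η x hn]
    refine hT1 n _ x fun y hy => ?_
    by_cases hyn : y ∈ Xn n
    · rw [chi_apply_of_mem (by simpa using hyn), hx y hy]
    · exact chi_apply_of_notMem (by simpa using hyn) _
  · have h1 := dist_eq_norm Q (Q + E)
    refine lt_of_eq_of_lt h1 ?_
    have h2 : Q - (Q + E) = -E := by abel
    rw [h2]
    exact lt_of_eq_of_lt (ContinuousLinearMap.opNorm_neg E) (hE1.trans_lt (half_lt_self hε))

end Approximation

/-! ### Equivalences for a projection and its uniformization -/

section Equivalences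

variable {X H : Type*} [MetricSpace X] [NormedAddCommGroup H] [InnerProductSpace ℂ H]
  {Xn : ℕ → Finset X} {P : Ell2 X H →L[ℂ] Ell2 X H} {ξ : ℕ → Ell2 X H}

theorem IsAssociatedTo.quasiLocal_iff_assocMass (h : IsAssociatedTo Xn P ξ)
    (hd : Pairwise fun n m => Disjoint (Xn n) (Xn m)) (hc : ∀ x : X, ∃ n, x ∈ Xn n) :
    QuasiLocal P ↔ MeasuredAsymptoticExpanders (fun n => Xn n) (assocMass Xn P) := by
  have h1 : assocMass Xn P = fun n (x : Xn n) => ‖ξ n x‖ ^ 2 :=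
    funext fun n => funext fun x => h.assocMass_eq n x
  rw [h1, h.quasiLocal_iff hd hc]

/-- Both sides are the expander condition for the same measures `‖ξ n x‖²`. -/
theorem IsAssociatedTo.quasiLocal_uniformization_iff {Q : Ell2 X ℂ →L[ℂ] Ell2 X ℂ}
    (h : IsAssociatedTo Xn P ξ) (hQ : IsAssociatedTo Xn Q fun n => uniformVec (ξ n))
    (hd : Pairwise fun n m => Disjoint (Xn n) (Xn m)) (hc : ∀ x : X, ∃ n, x ∈ Xn n) :
    QuasiLocal Q ↔ QuasiLocal P := by
  have h1 : ∀ n x, ‖uniformVec (ξ n) x‖ = ‖ξ n x‖ := fun n x => by simp [uniformVec_apply]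
  rw [h.quasiLocal_iff hd hc, hQ.quasiLocal_iff hd hc]
  simp only [h1]

theorem IsAssociatedTo.mem_uniformRoeAlgebra_iff_quasiLocal {Q : Ell2 X ℂ →L[ℂ] Ell2 X ℂ}
    (h : IsAssociatedTo Xn P ξ) (hX : BoundedGeometry X)
    (hQ : IsAssociatedTo Xn Q fun n => uniformVec (ξ n))
    (hd : Pairwise fun n m => Disjoint (Xn n) (Xn m)) (hc : ∀ x : X, ∃ n, x ∈ Xn n) :
    Q ∈ uniformRoeAlgebra X ↔ QuasiLocal Q :=
  ⟨quasiLocal_of_mem_closure, fun hq =>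
    mem_uniformRoeAlgebra_of_measuredAsymptoticExpanders hX hd hc hQ
      ((h.quasiLocal_iff hd hc).1 ((h.quasiLocal_uniformization_iff hQ hd hc).1 hq))⟩

end Equivalences

end RoeBlock

theorem theoremB {X : Type*} [MetricSpace X] (Xn : ℕ → Finset X)
    (hX : RoeBlock.IsCoarseDisjointUnion Xn) :
    -- quasi-locality, for an arbitrary coefficient Hilbert space, without bounded geometry
    (∀ (H : Type*) [NormedAddCommGroup H] [InnerProductSpace ℂ H] [CompleteSpace H]
      (P : RoeBlock.Ell2 X H →L[ℂ] RoeBlock.Ell2 X H),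
      RoeBlock.IsBlockRankOneProjection Xn P →
        (RoeBlock.QuasiLocal P ↔
          RoeBlock.MeasuredAsymptoticExpanders (fun n => Xn n) (RoeBlock.assocMass Xn P))) ∧
    -- the uniform case
    (RoeBlock.BoundedGeometry X →
      ∀ P : RoeBlock.Ell2 X ℂ →L[ℂ] RoeBlock.Ell2 X ℂ,
        RoeBlock.IsBlockRankOneProjection Xn P →
          List.TFAE
            [P ∈ RoeBlock.uniformRoeAlgebra X,
              RoeBlock.QuasiLocal P,
              RoeBlock.MeasuredAsymptoticExpanders (fun n => Xn n)
                (RoeBlock.assocMass Xn P)]) ∧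
    -- the case of an infinite-dimensional separable coefficient Hilbert space
    (RoeBlock.BoundedGeometry X →
      ∀ (H : Type*) [NormedAddCommGroup H] [InnerProductSpace ℂ H] [CompleteSpace H]
        [TopologicalSpace.SeparableSpace H] (P : RoeBlock.Ell2 X H →L[ℂ] RoeBlock.Ell2 X H),
        ¬ FiniteDimensional ℂ H →
        RoeBlock.IsBlockRankOneProjection Xn P →
          (∃! Q : RoeBlock.Ell2 X ℂ →L[ℂ] RoeBlock.Ell2 X ℂ,
            RoeBlock.IsUniformization Xn P Q) ∧
          ∀ Q : RoeBlock.Ell2 X ℂ →L[ℂ] RoeBlock.Ell2 X ℂ,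
            RoeBlock.IsUniformization Xn P Q →
              List.TFAE
                [P ∈ RoeBlock.roeAlgebra X H,
                  RoeBlock.QuasiLocal P,
                  RoeBlock.MeasuredAsymptoticExpanders (fun n => Xn n)
                    (RoeBlock.assocMass Xn P),
                  Q ∈ RoeBlock.uniformRoeAlgebra X,
                  RoeBlock.QuasiLocal Q]) := by
  have hd := hX.disjoint
  have hc := hX.cover
  refine ⟨fun H _ _ _ P hP => ?_, fun hG P hP => ?_, fun hG H _ _ _ _ P _ hP => ?_⟩
  · obtain ⟨ξ, hξ⟩ := hP.exists_isAssociatedTo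
    exact hξ.quasiLocal_iff_assocMass hd hc
  · obtain ⟨ξ', hξ'⟩ := hP.exists_isAssociatedTo
    obtain ⟨Q, ξ, hξ, hQ⟩ := RoeBlock.exists_isUniformization hd hc hξ'
    have h1 : P ∈ RoeBlock.uniformRoeAlgebra X → RoeBlock.QuasiLocal P :=
      RoeBlock.quasiLocal_of_mem_closure
    have h2 := hξ.quasiLocal_iff_assocMass hd hc
    -- Even for `H = ℂ` the vectors may carry phases, so the walk argument is applied to the
    -- uniformization and transported back to `P`.
    have h3 : RoeBlock.QuasiLocal P → P ∈ RoeBlock.uniformRoeAlgebra X := fun hq =>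
      RoeBlock.roeAlgebra_subset (RoeBlock.mem_roeAlgebra_of_uniformization hd hc hξ hQ
        ((hξ.mem_uniformRoeAlgebra_iff_quasiLocal hG hQ hd hc).2
          ((hξ.quasiLocal_uniformization_iff hQ hd hc).2 hq)))
    tfae_have 1 ↔ 2 := ⟨h1, h3⟩
    tfae_have 2 ↔ 3 := h2
    tfae_finish
  · obtain ⟨ξ', hξ'⟩ := hP.exists_isAssociatedTo
    obtain ⟨Q₀, hQ₀⟩ := RoeBlock.exists_isUniformization hd hc hξ'
    refine ⟨⟨Q₀, hQ₀, fun Q hQ => hQ.eq hc hQ₀⟩, fun Q hQ => ?_⟩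
    obtain ⟨ξ, hξ, hQ⟩ := hQ
    have h1 : P ∈ RoeBlock.roeAlgebra X H → RoeBlock.QuasiLocal P := fun h =>
      RoeBlock.quasiLocal_of_mem_closure (RoeBlock.roeAlgebra_subset h)
    tfae_have 1 → 2 := h1
    tfae_have 2 ↔ 3 := hξ.quasiLocal_iff_assocMass hd hc
    tfae_have 5 ↔ 2 := hξ.quasiLocal_uniformization_iff hQ hd hc
    tfae_have 4 ↔ 5 := hξ.mem_uniformRoeAlgebra_iff_quasiLocal hG hQ hd hc
    tfae_have 4 → 1 := RoeBlock.mem_roeAlgebra_of_uniformization hd hc hξ hQ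
    tfae_finish
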